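/- Let $d\in\mathbb N$, $c>0$ and $\mathcal L=L^2(\mathbb R^d)\cap L^\infty(\mathbb R^d)$ (complex-valued functions modulo a.e. equality), with $\langle f,g\rangle=\int\overline{f(t)}g(t)\,dt$. The square of white noise algebra $\mathcal A$ is the unital complex $*$-algebra generated by symbols $B_f,N_f$ ($f\in\mathcal L$) with the relations $$[B_f,B_g^*]=2c\langle f,g\rangle+4N_{\bar f g},\quad [N_f,B_g^*]=2B_{fg}^*,\quad [B_f,B_g]=[N_f,N_g]=0,\quad N_f^*=N_{\bar f}\qquad(f,g\in\mathcal L).$$ A Fock representation of $\mathcal A$ is a unital algebra homomorphism $\pi$ from $\mathcal A$ to the linear operators on a complex pre-Hilbert space $H$ with $\langle \pi(a)x,y\rangle=\langle x,\pi(a^*)y\rangle$ for all $a\in\mathcal A$, $x,y\in H$, together with a unit vector $\Phi\in H$ such that $\pi(\mathcal A)\Phi=H$ and $\pi(B_f)\Phi=\pi(N_f)\Phi=0$ for all $f\in\mathcal L$. **Theorem 2.1.** A Fock representation of $\mathcal A$ exists. In every Fock representation the following holds. For every $f\in\mathcal L$ with $\|f\|_\infty<\frac12$ the exponential vector $$\psi(f)=\sum_{m=0}^\infty\frac{\pi(B_f^*)^m\Phi}{m!}$$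 exists, i.e. the series converges (unconditionally) in the Hilbert space completion of $H$. For all $f,g\in\mathcal L$ with $\|f\|_\infty<\frac12$ and $\|g\|_\infty<\frac12$ the function $t\mapsto\ln(1-4\overline{f(t)}g(t))$ (principal branch) is integrable on $\mathbb R^d$ and $$\langle\psi(f),\psi(g)\rangle=\exp\Bigl(-\frac c2\int_{\mathbb R^d}\ln\bigl(1-4\overline{f(t)}g(t)\bigr)\,dt\Bigr),$$ where inner products are antilinear in the first argument. -/

import Mathlib

open MeasureTheory
open scoped ENNReal ComplexConjugate

noncomputable section

namespace SWN

/-! ### The test function space -/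

/-- The test function space `L²(ℝᵈ) ∩ L^∞(ℝᵈ)` of complex functions, modulo a.e. equality. -/
def TestFun (d : ℕ) : Type :=
  {f : EuclideanSpace ℝ (Fin d) →ₘ[volume] ℂ // MemLp f 2 volume ∧ MemLp f ∞ volume}

namespace TestFun

variable {d : ℕ}

/-- A representative of the class. -/
instance : CoeFun (TestFun d) (fun _ => EuclideanSpace ℝ (Fin d) → ℂ) := ⟨fun f => f.1⟩

/-- Pointwise complex conjugation. -/
instance : Star (TestFun d) :=
  ⟨fun f => ⟨star f.1, (memLp_congr_ae (AEEqFun.coeFn_star f.1)).2 f.2.1.star,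
    (memLp_congr_ae (AEEqFun.coeFn_star f.1)).2 f.2.2.star⟩⟩

/-- Pointwise multiplication. -/
instance : Mul (TestFun d) :=
  ⟨fun f g => ⟨f.1 * g.1, (memLp_congr_ae (AEEqFun.coeFn_mul f.1 g.1)).2 (g.2.1.mul f.2.2),
    (memLp_congr_ae (AEEqFun.coeFn_mul f.1 g.1)).2 (g.2.2.mul f.2.2)⟩⟩

/-- The `L²` inner product, antilinear in the first argument. -/
def l2inner (f g : TestFun d) : ℂ := ∫ t, conj (f t) * g t

/-- The `L^∞` norm. -/
def supNorm (f : TestFun d) : ℝ≥0∞ := eLpNorm f ∞ volume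

end TestFun

/-! ### The free unital `*`-algebra over a set of symbols -/

/-- The free unital complex `*`-algebra on `X`: noncommutative polynomials in the letters
`x = (x, false)` and `x^* = (x, true)`. -/
def FreeStarAlgebra (X : Type) : Type := FreeAlgebra ℂ (X × Bool)

namespace FreeStarAlgebra

variable {X : Type}

instance : Ring (FreeStarAlgebra X) := inferInstanceAs (Ring (FreeAlgebra ℂ (X × Bool)))

instance : Algebra ℂ (FreeStarAlgebra X) :=
  inferInstanceAs (Algebra ℂ (FreeAlgebra ℂ (X × Bool)))

/-- The letter `x`, or `x^*`, as an element of the algebra. -/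
def letter (p : X × Bool) : FreeStarAlgebra X := FreeAlgebra.ι ℂ p

/-- The generator `x`. -/
def of (x : X) : FreeStarAlgebra X := letter (x, false)

/-- The antilinear antiautomorphism that exchanges the letters `x` and `x^*`, as a ring
homomorphism to the opposite algebra. -/
def starHom (X : Type) : FreeStarAlgebra X →+* (FreeStarAlgebra X)ᵐᵒᵖ :=
  letI : Algebra ℂ (FreeStarAlgebra X)ᵐᵒᵖ :=
    ((algebraMap ℂ (FreeStarAlgebra X)ᵐᵒᵖ).comp (starRingEnd ℂ)).toAlgebra'
      (fun r x => Algebra.commutes (conj r) x)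
  (FreeAlgebra.lift ℂ
    (fun p : X × Bool => MulOpposite.op (letter (p.1, !p.2)))).toRingHom

theorem starHom_letter (p : X × Bool) :
    starHom X (letter p) = MulOpposite.op (letter (p.1, !p.2)) := by
  let : Algebra ℂ (FreeStarAlgebra X)ᵐᵒᵖ :=
    ((algebraMap ℂ (FreeStarAlgebra X)ᵐᵒᵖ).comp (starRingEnd ℂ)).toAlgebra'
      (fun r x => Algebra.commutes (conj r) x)
  exact FreeAlgebra.lift_ι_apply (R := ℂ)
    (fun p : X × Bool => MulOpposite.op (letter (p.1, !p.2))) p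

theorem starHom_algebraMap (z : ℂ) :
    starHom X (algebraMap ℂ _ z) = MulOpposite.op (algebraMap ℂ _ (conj z)) := by
  let : Algebra ℂ (FreeStarAlgebra X)ᵐᵒᵖ :=
    ((algebraMap ℂ (FreeStarAlgebra X)ᵐᵒᵖ).comp (starRingEnd ℂ)).toAlgebra'
      (fun r x => Algebra.commutes (conj r) x)
  exact AlgHom.commutes (FreeAlgebra.lift ℂ
    (fun p : X × Bool => MulOpposite.op (letter (p.1, !p.2)))) z

theorem induction {C : FreeStarAlgebra X → Prop} (hz : ∀ z, C (algebraMap ℂ _ z))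
    (hl : ∀ p, C (letter p)) (hm : ∀ a b, C a → C b → C (a * b))
    (ha : ∀ a b, C a → C b → C (a + b)) (a : FreeStarAlgebra X) : C a :=
  FreeAlgebra.induction (R := ℂ) (X := X × Bool) (motive := C) hz hl hm ha a

theorem starHom_starHom (a : FreeStarAlgebra X) :
    (starHom X (starHom X a).unop).unop = a := by
  induction a using induction with
  | hz z => simp [starHom_algebraMap]
  | hl p => simp [starHom_letter]
  | hm a b ha hb => rw [map_mul, MulOpposite.unop_mul, map_mul, MulOpposite.unop_mul, ha, hb]
  | ha a b ha hb => rw [map_add, MulOpposite.unop_add, map_add, MulOpposite.unop_add, ha, hb]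

instance : StarRing (FreeStarAlgebra X) where
  star a := (starHom X a).unop
  star_involutive := starHom_starHom
  star_mul a b := by rw [map_mul, MulOpposite.unop_mul]
  star_add a b := by rw [map_add, MulOpposite.unop_add]

theorem star_algebraMap (z : ℂ) :
    star (algebraMap ℂ (FreeStarAlgebra X) z) = algebraMap ℂ _ (conj z) :=
  congrArg MulOpposite.unop (starHom_algebraMap z)

instance : StarModule ℂ (FreeStarAlgebra X) where
  star_smul z a := by
    rw [Algebra.smul_def, star_mul, star_algebraMap, Algebra.smul_def]
    exact (Algebra.commutes _ _).symm

end FreeStarAlgebra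

/-! ### The square of white noise algebra -/

/-- The generating symbols `B_f`, `N_f`. -/
inductive Symb (d : ℕ) : Type
  | B (f : TestFun d) : Symb d
  | N (f : TestFun d) : Symb d

/-- The defining relations. Being closed under `star`, they generate a `*`-ideal. -/
inductive Rel (d : ℕ) (c : ℝ) : FreeStarAlgebra (Symb d) → FreeStarAlgebra (Symb d) → Prop
  /-- `[B_f, B_g^*] = 2c⟨f, g⟩ + 4 N_{f̄ g}` -/
  | B_Bstar (f g : TestFun d) :
      Rel d c
        (.of (.B f) * star (.of (.B g)) - star (.of (.B g)) * .of (.B f))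
        (algebraMap ℂ _ (2 * c * TestFun.l2inner f g) + (4 : ℂ) • .of (.N (star f * g)))
  /-- `[N_f, B_g^*] = 2 B_{f g}^*` -/
  | N_Bstar (f g : TestFun d) :
      Rel d c
        (.of (.N f) * star (.of (.B g)) - star (.of (.B g)) * .of (.N f))
        ((2 : ℂ) • star (.of (.B (f * g))))
  /-- `[B_f, B_g] = 0` -/
  | B_B (f g : TestFun d) :
      Rel d c (.of (.B f) * .of (.B g) - .of (.B g) * .of (.B f)) 0
  /-- `[N_f, N_g] = 0` -/
  | N_N (f g : TestFun d) :
      Rel d c (.of (.N f) * .of (.N g) - .of (.N g) * .of (.N f)) 0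
  /-- `N_f^* = N_{f̄}` -/
  | N_star (f : TestFun d) :
      Rel d c (star (.of (.N f))) (.of (.N (star f)))
  /-- The adjoint of a relation is a relation. -/
  | adjoint {a b : FreeStarAlgebra (Symb d)} : Rel d c a b → Rel d c (star a) (star b)

/-- The square of white noise algebra over `L²(ℝᵈ) ∩ L^∞(ℝᵈ)` with constant `c`. -/
def Alg (d : ℕ) (c : ℝ) : Type := RingQuot (Rel d c)

namespace Alg

variable {d : ℕ} {c : ℝ}

instance : Ring (Alg d c) := inferInstanceAs (Ring (RingQuot (Rel d c)))

instance : Algebra ℂ (Alg d c) := inferInstanceAs (Algebra ℂ (RingQuot (Rel d c)))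

instance : StarRing (Alg d c) := RingQuot.starRing (Rel d c) (fun _ _ h => h.adjoint)

/-- The quotient map. -/
def mk (d : ℕ) (c : ℝ) : FreeStarAlgebra (Symb d) →ₐ[ℂ] Alg d c := RingQuot.mkAlgHom ℂ (Rel d c)

theorem mk_surjective : Function.Surjective (mk d c) := RingQuot.mkAlgHom_surjective ℂ (Rel d c)

theorem mk_star (a : FreeStarAlgebra (Symb d)) : mk d c (star a) = star (mk d c a) := by
  simp only [mk, RingQuot.mkAlgHom_def, RingQuot.mkRingHom_def]
  rfl

instance : StarModule ℂ (Alg d c) where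
  star_smul z a := by
    obtain ⟨a, rfl⟩ := mk_surjective a
    rw [← map_smul, ← mk_star, star_smul, map_smul, mk_star]

/-- The element `B_f`. -/
def B (c : ℝ) (f : TestFun d) : Alg d c := mk d c (.of (.B f))

/-- The element `N_f`. -/
def N (c : ℝ) (f : TestFun d) : Alg d c := mk d c (.of (.N f))

end Alg

/-! ### Fock representations and exponential vectors -/

/-- A Fock representation on the pre-Hilbert space `H`: a unital `*`-representation with a
cyclic unit vector that is annihilated by all `B_f` and `N_f`. -/
structure FockRep (d : ℕ) (c : ℝ) (H : Type*) [NormedAddCommGroup H] [InnerProductSpace ℂ H] where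
  /-- The representation, by everywhere defined operators on `H`. -/
  π : Alg d c →ₐ[ℂ] Module.End ℂ H
  /-- `π(a^*)` is an adjoint of `π(a)`. -/
  inner_π : ∀ (a : Alg d c) (x y : H), inner ℂ (π a x) y = inner ℂ x (π (star a) y)
  /-- The vacuum vector `Φ`. -/
  vac : H
  norm_vac : ‖vac‖ = 1
  cyclic : ∀ x : H, ∃ a : Alg d c, π a vac = x
  B_vac : ∀ f : TestFun d, π (Alg.B c f) vac = 0
  N_vac : ∀ f : TestFun d, π (Alg.N c f) vac = 0

namespace FockRep

variable {d : ℕ} {c : ℝ} {H : Type*} [NormedAddCommGroup H] [InnerProductSpace ℂ H]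

/-- The term `B_f^{*m} Φ / m!`, as an element of the Hilbert space completion of `H`. -/
def expTerm (R : FockRep d c H) (f : TestFun d) (m : ℕ) : UniformSpace.Completion H :=
  (((m.factorial : ℂ)⁻¹ • R.π (star (Alg.B c f) ^ m) R.vac : H) : UniformSpace.Completion H)

/-- The exponential vector `ψ(f)` exists: its series converges in the completion of `H`. -/
def ExpExists (R : FockRep d c H) (f : TestFun d) : Prop := Summable (R.expTerm f)

/-- The exponential vector `ψ(f)`, meaningful if `R.ExpExists f`. -/
def expVec (R : FockRep d c H) (f : TestFun d) : UniformSpace.Completion H :=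
  ∑' m, R.expTerm f m

end FockRep

end SWN

end

/-! Inner products. Write `Φ_m(f) = B_f^{*m} Φ / m!`. Commuting annihilators to the vacuum gives
`N_k Φ_{m+1}(g) = 2 B_{kg}^* Φ_m(g)` and `B_f Φ_{m+1}(g) = 2c⟨f,g⟩ Φ_m(g) + 2 N_{f̄g} Φ_m(g)`
(`N_vec`, `B_vec`). Moving operators across the inner product therefore lowers the particle number
while collecting powers of `f̄g`, and `a_m = ⟨Φ_m(f), Φ_m(g)⟩` satisfies `(m+1) a_{m+1} = ∑_{j≤m}
q_j a_{m-j}` with `q_j = (c/2) ∫ (4f̄g)^{j+1}` (`coef_recursion'`). This is `F' = QF` for the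
generating functions. As `|4f̄g| ≤ ρ < 1` a.e., `q_j` decays like `ρ^j`, hence `a_m` like `θ^m` for
every `θ > ρ`, and `F(1) = exp(∑ q_j/(j+1))`, which is the logarithmic integral. The case `f = g`
gives absolute convergence of the exponential series, and different particle numbers are orthogonal.

Existence. The relations are realised on polynomials in the vectors `(n, u)`, a boson Fock space
over countably many layers of `L²`. On one particle the layers carry a lowest weight representation
of `sl₂`, multiplied pointwise by test functions. `N_h`, `B_h` act as derivations, and `B_h^*` is a
derivation plus multiplication by `(0, h)`, whose commutator with annihilation yields the scalar
`2c⟨f,g⟩`. Derivation identities need only be checked on variables (`derivation_commutator`). The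
Fock form is positive by induction on the degree (`form_self_nonneg`), and the GNS construction for
the vacuum polynomial `1` makes the vacuum cyclic. -/

noncomputable section

namespace SWN

/-! ### Arithmetic of test functions -/

namespace TestFun

variable {d : ℕ}

theorem coeFn_mul (f g : TestFun d) : ⇑(f * g) =ᵐ[volume] fun t => f t * g t :=
  AEEqFun.coeFn_mul f.1 g.1

theorem coeFn_star (f : TestFun d) : ⇑(star f) =ᵐ[volume] fun t => conj (f t) :=
  AEEqFun.coeFn_star f.1

theorem ext_ae {f g : TestFun d} (h : ⇑f =ᵐ[volume] ⇑g) : f = g :=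
  Subtype.ext (AEEqFun.ext h)

theorem mul_comm' (f g : TestFun d) : f * g = g * f := Subtype.ext (mul_comm f.1 g.1)

theorem mul_assoc' (f g h : TestFun d) : f * g * h = f * (g * h) :=
  Subtype.ext (mul_assoc f.1 g.1 h.1)

theorem star_star' (f : TestFun d) : star (star f) = f := by
  apply ext_ae
  filter_upwards [coeFn_star (star f), coeFn_star f] with t h1 h2
  rw [h1, h2, Complex.conj_conj]

theorem star_mul' (f g : TestFun d) : star (f * g) = star f * star g := by
  apply ext_ae
  filter_upwards [coeFn_star (f * g), coeFn_mul f g, coeFn_mul (star f) (star g),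
    coeFn_star f, coeFn_star g] with t h1 h2 h3 h4 h5
  rw [h1, h2, h3, h4, h5, map_mul]

theorem conj_l2inner (f g : TestFun d) : conj (l2inner f g) = l2inner g f := by
  rw [l2inner, l2inner, ← integral_conj]
  simp [mul_comm]

theorem l2inner_mul_left (f g h : TestFun d) : l2inner (h * f) g = l2inner f (star h * g) := by
  refine integral_congr_ae ?_
  filter_upwards [coeFn_mul h f, coeFn_mul (star h) g, coeFn_star h] with t h1 h2 h3
  rw [h1, h2, h3, map_mul]; ring

end TestFun

/-! ### The relations as identities in the quotient algebra -/

namespace Alg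

variable {d : ℕ} {c : ℝ}

theorem mk_rel {a b : FreeStarAlgebra (Symb d)} (h : Rel d c a b) : mk d c a = mk d c b :=
  RingQuot.mkAlgHom_rel ℂ h

theorem B_mul_star_B (f g : TestFun d) : B c f * star (B c g) =
    star (B c g) * B c f + algebraMap ℂ _ (2 * c * TestFun.l2inner f g)
      + (4 : ℂ) • N c (star f * g) := by
  have := mk_rel (Rel.B_Bstar (c := c) f g)
  simp only [map_sub, map_mul, map_add, mk_star, map_smul, AlgHom.commutes] at this
  rw [add_assoc, ← sub_eq_iff_eq_add']
  simpa [B, N] using this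

theorem N_mul_star_B (f g : TestFun d) : N c f * star (B c g) =
    star (B c g) * N c f + (2 : ℂ) • star (B c (f * g)) := by
  have := mk_rel (Rel.N_Bstar (c := c) f g)
  simp only [map_sub, map_mul, mk_star, map_smul] at this
  rw [← sub_eq_iff_eq_add']
  exact this

theorem B_mul_B (f g : TestFun d) : B c f * B c g = B c g * B c f := by
  have := mk_rel (Rel.B_B (c := c) f g)
  simp only [map_sub, map_mul, map_zero] at this
  exact sub_eq_zero.1 this

theorem star_B_mul_star_B (f g : TestFun d) :
    star (B c f) * star (B c g) = star (B c g) * star (B c f) := by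
  rw [← star_mul, ← star_mul, B_mul_B]

theorem star_N (f : TestFun d) : star (N c f) = N c (star f) := by
  have := mk_rel (Rel.N_star (c := c) f)
  rw [mk_star] at this
  exact this

end Alg

/-! ### Particle vectors and the recursion for their inner products -/

namespace FockRep

variable {d : ℕ} {c : ℝ} {H : Type*} [NormedAddCommGroup H] [InnerProductSpace ℂ H]
  (R : FockRep d c H)

/-- The normalised `m`-particle vector `B_f^{*m} Φ / m!`. -/
def vec (f : TestFun d) (m : ℕ) : H := (m.factorial : ℂ)⁻¹ • R.π (star (Alg.B c f) ^ m) R.vac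

theorem vec_zero (f : TestFun d) : R.vec f 0 = R.vac := by simp [vec]

theorem star_B_vec (f : TestFun d) (m : ℕ) :
    R.π (star (Alg.B c f)) (R.vec f m) = ((m : ℂ) + 1) • R.vec f (m + 1) := by
  have h : ((m : ℂ) + 1) ≠ 0 := by exact_mod_cast m.succ_ne_zero
  simp only [vec, map_smul, smul_smul, Nat.factorial_succ, pow_succ', map_mul, Module.End.mul_apply]
  congr 1
  push_cast
  field_simp

theorem inner_star_B (f : TestFun d) (x y : H) :
    inner ℂ (R.π (star (Alg.B c f)) x) y = inner ℂ x (R.π (Alg.B c f) y) := by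
  rw [R.inner_π, star_star]

theorem inner_B (f : TestFun d) (x y : H) :
    inner ℂ (R.π (Alg.B c f) x) y = inner ℂ x (R.π (star (Alg.B c f)) y) := R.inner_π _ _ _

theorem inner_N (f : TestFun d) (x y : H) :
    inner ℂ (R.π (Alg.N c (star f)) x) y = inner ℂ x (R.π (Alg.N c f) y) := by
  rw [R.inner_π, Alg.star_N, TestFun.star_star']

theorem B_star_B (f g : TestFun d) (x : H) :
    R.π (Alg.B c f) (R.π (star (Alg.B c g)) x) = R.π (star (Alg.B c g)) (R.π (Alg.B c f) x)
      + (2 * c * TestFun.l2inner f g) • x + (4 : ℂ) • R.π (Alg.N c (star f * g)) x := by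
  rw [← Module.End.mul_apply, ← map_mul, Alg.B_mul_star_B]
  generalize 2 * (c : ℂ) * TestFun.l2inner f g = z
  simp only [map_add, map_mul, map_smul, AlgHom.commutes, LinearMap.add_apply,
    Module.End.mul_apply, Module.algebraMap_end_apply, LinearMap.smul_apply]

theorem N_star_B (f g : TestFun d) (x : H) :
    R.π (Alg.N c f) (R.π (star (Alg.B c g)) x) = R.π (star (Alg.B c g)) (R.π (Alg.N c f) x)
      + (2 : ℂ) • R.π (star (Alg.B c (f * g))) x := by
  rw [← Module.End.mul_apply, ← map_mul, Alg.N_mul_star_B]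
  simp only [map_add, map_mul, map_smul, LinearMap.add_apply,
    Module.End.mul_apply, LinearMap.smul_apply]

theorem star_B_star_B (f g : TestFun d) (x : H) :
    R.π (star (Alg.B c f)) (R.π (star (Alg.B c g)) x) =
      R.π (star (Alg.B c g)) (R.π (star (Alg.B c f)) x) := by
  rw [← Module.End.mul_apply, ← map_mul, Alg.star_B_mul_star_B, map_mul, Module.End.mul_apply]

/-- `[N_f, B_g^*]` commutes with `B_g^*`, so `N_f` differentiates the power `B_g^{*(m+1)}`; the
resulting factor `m + 1` is absorbed by the factorial. -/
theorem N_vec (f g : TestFun d) (m : ℕ) :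
    R.π (Alg.N c f) (R.vec g (m + 1)) =
      (2 : ℂ) • R.π (star (Alg.B c (f * g))) (R.vec g m) := by
  have key : ∀ m : ℕ, ((m : ℂ) + 1) • R.π (Alg.N c f) (R.vec g (m + 1)) =
      R.π (star (Alg.B c g)) (R.π (Alg.N c f) (R.vec g m))
      + (2 : ℂ) • R.π (star (Alg.B c (f * g))) (R.vec g m) := fun m => by
    rw [← map_smul, ← star_B_vec, N_star_B]
  have hne : ∀ m : ℕ, ((m : ℂ) + 1) ≠ 0 := fun m => by exact_mod_cast m.succ_ne_zero
  induction m with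
  | zero =>
    have := key 0
    rw [vec_zero, N_vac, map_zero, zero_add] at this
    simpa [vec_zero] using this
  | succ m ih =>
    have h := key (m + 1)
    rw [ih, map_smul, star_B_star_B, star_B_vec, map_smul, smul_smul, ← add_smul] at h
    refine smul_right_injective H (hne (m + 1)) ?_
    simp only
    rw [h, smul_smul]
    congr 1
    push_cast; ring

theorem B_vec (f g : TestFun d) (m : ℕ) :
    R.π (Alg.B c f) (R.vec g (m + 1)) = (2 * c * TestFun.l2inner f g) • R.vec g m
      + (2 : ℂ) • R.π (Alg.N c (star f * g)) (R.vec g m) := by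
  have key : ∀ m : ℕ, ((m : ℂ) + 1) • R.π (Alg.B c f) (R.vec g (m + 1)) =
      R.π (star (Alg.B c g)) (R.π (Alg.B c f) (R.vec g m))
      + (2 * c * TestFun.l2inner f g) • R.vec g m
      + (4 : ℂ) • R.π (Alg.N c (star f * g)) (R.vec g m) := fun m => by
    rw [← map_smul, ← star_B_vec, B_star_B]
  have hne : ∀ m : ℕ, ((m : ℂ) + 1) ≠ 0 := fun m => by exact_mod_cast m.succ_ne_zero
  induction m with
  | zero =>
    have := key 0
    rw [vec_zero, B_vac, map_zero, zero_add, N_vac] at this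
    rw [vec_zero, N_vac]
    simpa using this
  | succ m ih =>
    have h := key (m + 1)
    -- By `N_vec` the commutator term equals one copy of `N Φ_{m+1}`, leaving `m` of the `m + 1`
    -- copies.
    have h2 : R.π (star (Alg.B c g)) (R.π (Alg.N c (star f * g)) (R.vec g m)) =
        (m : ℂ) • R.π (Alg.N c (star f * g)) (R.vec g (m + 1)) := by
      have h3 := R.N_star_B (star f * g) g (R.vec g m)
      rw [star_B_vec, map_smul, ← N_vec, add_smul, one_smul] at h3
      exact (add_right_cancel h3).symm
    rw [ih, map_add, map_smul, star_B_vec, map_smul, h2] at h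
    refine smul_right_injective H (hne (m + 1)) ?_
    simp only
    rw [h]
    push_cast
    module

/-- The coefficients of the inner product of exponential vectors. -/
def coef (f g : TestFun d) (m : ℕ) : ℂ := inner ℂ (R.vec f m) (R.vec g m)

theorem coef_zero (f g : TestFun d) : R.coef f g 0 = 1 := by
  rw [coef, vec_zero, vec_zero, inner_self_eq_norm_sq_to_K, R.norm_vac]; simp

theorem succ_mul_coef_succ (f g : TestFun d) (m : ℕ) :
    ((m : ℂ) + 1) * R.coef f g (m + 1) = 2 * c * TestFun.l2inner f g * R.coef f g m
      + 2 * inner ℂ (R.vec f m) (R.π (Alg.N c (star f * g)) (R.vec g m)) := by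
  have h : ((m : ℂ) + 1) * R.coef f g (m + 1) =
      inner ℂ (R.π (star (Alg.B c f)) (R.vec f m)) (R.vec g (m + 1)) := by
    rw [star_B_vec, inner_smul_left, coef]; simp
  rw [h, inner_star_B, B_vec, inner_add_right, inner_smul_right, inner_smul_right, coef]

/-- `N_k` moves to the left vector, where it becomes `2 B_{k̄f}^*`; the adjoint of that acts on the
right vector by `B_vec`. Both particle numbers drop by one and `k` is replaced by `k f̄ g`. -/
theorem inner_N_vec_succ (f g k : TestFun d) (m n : ℕ) :
    inner ℂ (R.vec f (m + 1)) (R.π (Alg.N c k) (R.vec g (n + 1))) =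
      4 * (c * TestFun.l2inner (star k * f) g * inner ℂ (R.vec f m) (R.vec g n)
        + inner ℂ (R.vec f m) (R.π (Alg.N c (star (star k * f) * g)) (R.vec g n))) := by
  rw [← inner_N, N_vec, inner_smul_left, inner_star_B, B_vec, inner_add_right, inner_smul_right,
    inner_smul_right, map_ofNat]
  ring

theorem inner_N_vec (f g k : TestFun d) (m : ℕ) :
    inner ℂ (R.vec f m) (R.π (Alg.N c k) (R.vec g m)) =
      c * ∑ j ∈ Finset.range m, 4 ^ (j + 1) *
        (∫ t, k t * (conj (f t) * g t) ^ (j + 1)) * R.coef f g (m - 1 - j) := by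
  induction m generalizing k with
  | zero => simp [vec_zero, N_vac]
  | succ m ih =>
    rw [inner_N_vec_succ, ih, Finset.sum_range_succ', ← coef]
    have h1 : TestFun.l2inner (star k * f) g = ∫ t, k t * (conj (f t) * g t) ^ (0 + 1) := by
      rw [TestFun.l2inner_mul_left, TestFun.star_star']
      refine integral_congr_ae ?_
      filter_upwards [TestFun.coeFn_mul k g] with t h
      rw [h]; ring
    have h2 : ∀ j : ℕ, ∫ t, (star (star k * f) * g) t * (conj (f t) * g t) ^ (j + 1) =
        ∫ t, k t * (conj (f t) * g t) ^ (j + 1 + 1) := fun j => by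
      refine integral_congr_ae ?_
      filter_upwards [TestFun.coeFn_mul (star (star k * f)) g, TestFun.coeFn_star (star k * f),
        TestFun.coeFn_mul (star k) f, TestFun.coeFn_star k] with t h1 h2 h3 h4
      rw [h1, h2, h3, h4, map_mul, Complex.conj_conj]; ring
    simp only [h1, h2, Nat.add_sub_cancel, Nat.sub_zero, Finset.mul_sum, mul_add]
    rw [add_comm]
    congr 1
    · refine Finset.sum_congr rfl fun j _ => ?_
      rw [show m - 1 - j = m - (j + 1) by omega]; ring
    · ring

theorem coef_recursion (f g : TestFun d) (m : ℕ) :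
    ((m : ℂ) + 1) * R.coef f g (m + 1) = ∑ j ∈ Finset.range (m + 1),
      (2 * c * 4 ^ j * ∫ t, (conj (f t) * g t) ^ (j + 1)) * R.coef f g (m - j) := by
  rw [succ_mul_coef_succ, inner_N_vec, Finset.sum_range_succ']
  have h2 : ∀ j : ℕ, ∫ t, (star f * g) t * (conj (f t) * g t) ^ (j + 1) =
      ∫ t, (conj (f t) * g t) ^ (j + 1 + 1) := fun j => by
    refine integral_congr_ae ?_
    filter_upwards [TestFun.coeFn_mul (star f) g, TestFun.coeFn_star f] with t h1 h2
    rw [h1, h2]; ring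
  simp only [h2, TestFun.l2inner, Finset.mul_sum]
  rw [add_comm]
  congr 1
  · refine Finset.sum_congr rfl fun j _ => ?_
    rw [show m - 1 - j = m - (j + 1) by omega]; ring
  · simp

/-- The constant `1` need not be a test function, so no number operator is at hand. The induction
instead carries the matrix elements of all `N_k` along, since `B_vec` produces them. -/
theorem inner_vec_of_ne (f g : TestFun d) {m n : ℕ} (h : m ≠ n) :
    inner ℂ (R.vec f m) (R.vec g n) = 0 := by
  suffices H : ∀ m n : ℕ, m ≠ n → inner ℂ (R.vec f m) (R.vec g n) = 0 ∧
      ∀ k, inner ℂ (R.vec f m) (R.π (Alg.N c k) (R.vec g n)) = 0 from (H m n h).1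
  have hne : ∀ m : ℕ, ((m : ℂ) + 1) ≠ 0 := fun m => by exact_mod_cast m.succ_ne_zero
  have hl : ∀ (m : ℕ) (y : H), ((m : ℂ) + 1) * inner ℂ (R.vec f (m + 1)) y =
      inner ℂ (R.vec f m) (R.π (Alg.B c f) y) := fun m y => by
    rw [← inner_star_B, star_B_vec, inner_smul_left]; simp
  intro m
  induction m with
  | zero =>
    rintro (_ | n) h
    · exact absurd rfl h
    · refine ⟨?_, fun k => ?_⟩
      · refine (mul_eq_zero.1 ?_).resolve_left (hne n)
        rw [← inner_smul_right, ← star_B_vec, vec_zero, ← inner_B, B_vac, inner_zero_left]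
      · rw [← inner_N, vec_zero, N_vac, inner_zero_left]
  | succ m ih =>
    rintro (_ | n) h
    · refine ⟨(mul_eq_zero.1 ?_).resolve_left (hne m), fun k => ?_⟩
      · rw [hl, vec_zero, B_vac, inner_zero_right]
      · rw [vec_zero, N_vac, inner_zero_right]
    · obtain ⟨h1, h2⟩ := ih n (by omega)
      refine ⟨(mul_eq_zero.1 ?_).resolve_left (hne m), fun k => ?_⟩
      · rw [hl, B_vec, inner_add_right, inner_smul_right, inner_smul_right, h1, h2]; simp
      · rw [inner_N_vec_succ, h1, h2]; simp

end FockRep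

/-! ### Power series solution of `F' = QF` -/

/-- The sequence `a` is bounded by a geometric sequence of ratio `θ`. -/
def GeomBound (θ : ℝ) (a : ℕ → ℂ) : Prop := ∃ M : ℝ, ∀ m, ‖a m‖ ≤ M * θ ^ m

theorem GeomBound.mono {θ θ' : ℝ} {a : ℕ → ℂ} (h : GeomBound θ a) (h0 : 0 ≤ θ) (hle : θ ≤ θ') :
    GeomBound θ' a := by
  obtain ⟨M, hM⟩ := h
  have hM0 : 0 ≤ M := by simpa using (norm_nonneg _).trans (hM 0)
  exact ⟨M, fun m => (hM m).trans (by gcongr)⟩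

theorem GeomBound.summable_norm {θ : ℝ} {a : ℕ → ℂ} (h : GeomBound θ a) (h0 : 0 ≤ θ) {z : ℂ}
    (hz : ‖z‖ * θ < 1) : Summable fun m => ‖a m * z ^ m‖ := by
  obtain ⟨M, hM⟩ := h
  refine Summable.of_nonneg_of_le (fun _ => norm_nonneg _) (fun m => ?_)
    ((summable_geometric_of_lt_one (by positivity) hz).mul_left M)
  rw [norm_mul, norm_pow, mul_pow]
  calc ‖a m‖ * ‖z‖ ^ m ≤ M * θ ^ m * ‖z‖ ^ m := by gcongr; exact hM m
    _ = _ := by ring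

theorem GeomBound.hasDerivAt {θ : ℝ} {a : ℕ → ℂ} (h : GeomBound θ a) (h0 : 0 ≤ θ) {z : ℂ}
    (hz : ‖z‖ * θ < 1) : HasDerivAt (fun z : ℂ => ∑' m, a m * z ^ m)
      (∑' m : ℕ, ((m : ℂ) + 1) * a (m + 1) * z ^ m) z := by
  obtain ⟨M, hM⟩ := h
  -- A slightly larger disc is needed, on which the differentiated series has a uniform summable
  -- majorant.
  obtain ⟨r, hr, hr1⟩ : ∃ r : ℝ, ‖z‖ < r ∧ r * θ < 1 := by
    have hc : Filter.Tendsto (fun r : ℝ => r * θ) (nhdsWithin ‖z‖ (Set.Ioi ‖z‖))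
        (nhds (‖z‖ * θ)) :=
      ((continuous_id.mul continuous_const).tendsto _).mono_left nhdsWithin_le_nhds
    obtain ⟨r, h1, h2⟩ := ((hc.eventually (gt_mem_nhds hz)).and self_mem_nhdsWithin).exists
    exact ⟨r, h2, h1⟩
  have hr0 : 0 < r := (norm_nonneg z).trans_lt hr
  have hM0 : 0 ≤ M := by simpa using (norm_nonneg _).trans (hM 0)
  have hrθ : ‖r * θ‖ < 1 := by rwa [Real.norm_of_nonneg (mul_nonneg hr0.le h0)]
  have hu : Summable fun m : ℕ => M / r * ((m : ℝ) ^ 1 * (r * θ) ^ m) :=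
    (summable_pow_mul_geometric_of_norm_lt_one 1 hrθ).mul_left _
  have hg' : ∀ (n : ℕ) (y : ℂ), y ∈ Metric.ball (0 : ℂ) r →
      ‖a n * ((n : ℂ) * y ^ (n - 1))‖ ≤ M / r * ((n : ℝ) ^ 1 * (r * θ) ^ n) := by
    rintro (_ | n) y hy
    · simp
    · have hy' : ‖y‖ ≤ r := by simpa using (mem_ball_zero_iff.1 hy).le
      rw [norm_mul, norm_mul, norm_pow, Complex.norm_natCast]
      calc ‖a (n + 1)‖ * (((n + 1 : ℕ) : ℝ) * ‖y‖ ^ (n + 1 - 1))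
          ≤ (M * θ ^ (n + 1)) * (((n + 1 : ℕ) : ℝ) * r ^ (n + 1 - 1)) := by
            gcongr; exact hM _
        _ = _ := by
            rw [Nat.add_sub_cancel, mul_pow, pow_succ r]; field_simp
  have key := hasDerivAt_tsum_of_isPreconnected (g := fun n (y : ℂ) => a n * y ^ n) hu
    Metric.isOpen_ball (convex_ball (0 : ℂ) r).isPreconnected
    (fun n y _ => (hasDerivAt_pow n y).const_mul (a n)) hg' (y₀ := 0) (Metric.mem_ball_self hr0)
    (summable_of_ne_finset_zero (s := {0}) fun n hn => by
      simp [zero_pow (Finset.notMem_singleton.1 hn)])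
    (mem_ball_zero_iff.2 hr)
  refine key.congr_deriv ?_
  have hs : Summable fun n : ℕ => a n * ((n : ℂ) * z ^ (n - 1)) :=
    Summable.of_norm_bounded hu fun n => hg' n z (mem_ball_zero_iff.2 hr)
  rw [hs.tsum_eq_zero_add]
  simp only [Nat.cast_zero, zero_mul, mul_zero, zero_add, Nat.add_sub_cancel, Nat.cast_add,
    Nat.cast_one]
  exact tsum_congr fun n => by ring

/-- The coefficients of a solution of `F' = QF` decay geometrically if those of `Q` do. -/
theorem GeomBound.of_recursion {ρ : ℝ} {q a : ℕ → ℂ} (hq : GeomBound ρ q) (h0 : 0 ≤ ρ) {θ : ℝ}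
    (hθ : ρ < θ)
    (h : ∀ m : ℕ, ((m : ℂ) + 1) * a (m + 1) = ∑ j ∈ Finset.range (m + 1), q j * a (m - j)) :
    GeomBound θ a := by
  obtain ⟨C, hC⟩ := hq
  have hC0 : 0 ≤ C := by simpa using (norm_nonneg _).trans (hC 0)
  have hθ0 : 0 < θ := h0.trans_lt hθ
  have hs : Summable fun j : ℕ => (ρ / θ) ^ j :=
    summable_geometric_of_lt_one (by positivity) ((div_lt_one hθ0).2 hθ)
  set s := ∑' j : ℕ, (ρ / θ) ^ j
  -- Beyond `n₀` the factor `m + 1` in the recursion beats `C s / θ`, so the bound propagates with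
  -- the same constant; `M` is chosen to cover the terms up to `n₀`.
  obtain ⟨n₀, hn₀⟩ := exists_nat_ge (C * s / θ)
  set M := ∑ m ∈ Finset.range (n₀ + 1), ‖a m‖ / θ ^ m
  have hM0 : 0 ≤ M := Finset.sum_nonneg fun m _ => by positivity
  refine ⟨M, fun m => ?_⟩
  induction m using Nat.strong_induction_on with
  | _ m ih =>
  by_cases hm : m < n₀ + 1
  · rw [← div_le_iff₀ (by positivity)]
    exact Finset.single_le_sum (f := fun m => ‖a m‖ / θ ^ m) (fun m _ => by positivity)
      (Finset.mem_range.2 hm)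
  obtain ⟨m, rfl⟩ : ∃ k, m = k + 1 := ⟨m - 1, by omega⟩
  have hm' : (n₀ : ℝ) ≤ (m : ℝ) + 1 := by exact_mod_cast (by omega : n₀ ≤ m + 1)
  have h1 : ((m : ℝ) + 1) * ‖a (m + 1)‖ ≤ C * M * θ ^ m * s := by
    have : ((m : ℝ) + 1) * ‖a (m + 1)‖ = ‖((m : ℂ) + 1) * a (m + 1)‖ := by
      rw [norm_mul]; congr 1
      rw [← Nat.cast_succ, ← Nat.cast_succ, Complex.norm_natCast]
    rw [this, h]
    calc ‖∑ j ∈ Finset.range (m + 1), q j * a (m - j)‖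
        ≤ ∑ j ∈ Finset.range (m + 1), C * M * θ ^ m * (ρ / θ) ^ j := by
          refine norm_sum_le_of_le _ fun j hj => ?_
          have hj' : j ≤ m := Nat.lt_succ_iff.1 (Finset.mem_range.1 hj)
          rw [norm_mul]
          calc ‖q j‖ * ‖a (m - j)‖ ≤ (C * ρ ^ j) * (M * θ ^ (m - j)) := by
                gcongr
                · exact hC j
                · exact ih _ (by omega)
            _ = _ := by
                rw [div_pow, ← Nat.sub_add_cancel hj', Nat.add_sub_cancel, pow_add]
                field_simp
      _ = C * M * θ ^ m * ∑ j ∈ Finset.range (m + 1), (ρ / θ) ^ j :=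
          (Finset.mul_sum _ _ _).symm
      _ ≤ _ := by
          gcongr
          exact hs.sum_le_tsum _ fun j _ => by positivity
  have h2 : C * s ≤ ((m : ℝ) + 1) * θ := by
    rw [← div_le_iff₀ hθ0]; exact hn₀.trans hm'
  have h3 : ((m : ℝ) + 1) * ‖a (m + 1)‖ ≤ ((m : ℝ) + 1) * (M * θ ^ (m + 1)) := by
    calc _ ≤ C * M * θ ^ m * s := h1
      _ = (C * s) * (M * θ ^ m) := by ring
      _ ≤ (((m : ℝ) + 1) * θ) * (M * θ ^ m) := by gcongr
      _ = _ := by ring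
  exact le_of_mul_le_mul_left h3 (by positivity)

/-- The solution of `F' = QF`, `F(0) = 1`, at the point `1`, in terms of coefficients. -/
theorem tsum_eq_exp_of_recursion {ρ : ℝ} {q a : ℕ → ℂ} (hq : GeomBound ρ q) (h0 : 0 ≤ ρ)
    (hρ : ρ < 1) (ha0 : a 0 = 1)
    (h : ∀ m : ℕ, ((m : ℂ) + 1) * a (m + 1) = ∑ j ∈ Finset.range (m + 1), q j * a (m - j)) :
    ∑' m, a m = Complex.exp (∑' m : ℕ, q m / ((m : ℂ) + 1)) := by
  obtain ⟨θ, hθ, hθ1⟩ := exists_between hρ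
  have hθ0 : 0 < θ := h0.trans_lt hθ
  have ha : GeomBound θ a := hq.of_recursion h0 hθ h
  have hqθ : GeomBound θ q := hq.mono h0 hθ.le
  -- Coefficients of the primitive `P` of `Q` with `P(0) = 0`.
  set p : ℕ → ℂ := fun m => if m = 0 then 0 else q (m - 1) / m with hp
  have hpθ : GeomBound θ p := by
    obtain ⟨M, hM⟩ := hqθ
    have hM0 : 0 ≤ M := by simpa using (norm_nonneg _).trans (hM 0)
    refine ⟨M / θ, ?_⟩
    rintro (_ | m)
    · simp only [hp, if_true, norm_zero]; positivity
    · simp only [hp, Nat.succ_ne_zero, if_false, Nat.add_sub_cancel, norm_div,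
        Complex.norm_natCast]
      calc ‖q m‖ / ((m + 1 : ℕ) : ℝ) ≤ ‖q m‖ :=
            div_le_self (norm_nonneg _) (by exact_mod_cast Nat.succ_le_succ m.zero_le)
        _ ≤ M * θ ^ m := hM m
        _ = _ := by rw [pow_succ]; field_simp
  have hp1 : ∀ m : ℕ, ((m : ℂ) + 1) * p (m + 1) = q m := fun m => by
    have : ((m : ℂ) + 1) ≠ 0 := by exact_mod_cast m.succ_ne_zero
    simp only [hp, Nat.succ_ne_zero, if_false, Nat.add_sub_cancel]
    push_cast; field_simp
  set F : ℂ → ℂ := fun z => ∑' m, a m * z ^ m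
  set P : ℂ → ℂ := fun z => ∑' m, p m * z ^ m
  set r : ℝ := θ⁻¹
  have hr1 : 1 < r := (one_lt_inv₀ hθ0).2 hθ1
  have hmem : ∀ z ∈ Metric.ball (0 : ℂ) r, ‖z‖ * θ < 1 := fun z hz => by
    rw [mem_ball_zero_iff] at hz
    rw [← lt_div_iff₀ hθ0, one_div]; exact hz
  -- `F exp(-P)` is constant on a disc of radius `θ⁻¹ > 1`, which contains both `0` and `1`; the
  -- recursion enters as the Cauchy product `F' = P' F`.
  have hderiv : ∀ z ∈ Metric.ball (0 : ℂ) r,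
      HasDerivAt (fun z => F z * Complex.exp (-P z)) 0 z := by
    intro z hz
    have hz' := hmem z hz
    have hF := ha.hasDerivAt hθ0.le hz'
    have hP := hpθ.hasDerivAt hθ0.le hz'
    have hprod : ∑' m : ℕ, ((m : ℂ) + 1) * a (m + 1) * z ^ m =
        (∑' m : ℕ, ((m : ℂ) + 1) * p (m + 1) * z ^ m) * F z := by
      simp only [hp1]
      rw [tsum_mul_tsum_eq_tsum_sum_range_of_summable_norm (hqθ.summable_norm hθ0.le hz')
        (ha.summable_norm hθ0.le hz')]
      refine tsum_congr fun m => ?_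
      rw [h, Finset.sum_mul]
      refine Finset.sum_congr rfl fun j hj => ?_
      have hj' : j ≤ m := Nat.lt_succ_iff.1 (Finset.mem_range.1 hj)
      obtain ⟨k, rfl⟩ := Nat.exists_eq_add_of_le hj'
      rw [Nat.add_sub_cancel_left, pow_add]; ring
    refine (hF.mul hP.neg.cexp).congr_deriv ?_
    rw [hprod]; ring
  have hconst := Metric.isOpen_ball.is_const_of_deriv_eq_zero
    (convex_ball (0 : ℂ) r).isPreconnected
    (fun z hz => (hderiv z hz).differentiableAt.differentiableWithinAt)
    (fun z hz => (hderiv z hz).deriv)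
    (x := 1) (y := 0) (by simpa using hr1) (Metric.mem_ball_self (by linarith))
  have hF0 : F 0 = 1 := by
    simp only [F]
    rw [tsum_eq_single 0 fun m hm => by simp [hm]]
    simpa using ha0
  have hP0 : P 0 = 0 := by
    simp only [P]
    rw [tsum_eq_single 0 fun m hm => by simp [hm]]
    simp [hp]
  have hP1 : P 1 = ∑' m : ℕ, q m / ((m : ℂ) + 1) := by
    have hs : Summable fun m => p m * (1 : ℂ) ^ m :=
      (hpθ.summable_norm hθ0.le (by simpa using hθ1)).of_norm
    simp only [P]
    rw [hs.tsum_eq_zero_add]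
    simp [hp]
  rw [hF0, hP0, neg_zero, Complex.exp_zero, mul_one, Complex.exp_neg,
    mul_inv_eq_one₀ (Complex.exp_ne_zero _), hP1] at hconst
  simpa [F] using hconst

/-! ### Integrals of powers and of the logarithm -/

section PowerIntegrals

variable {α : Type*} [MeasurableSpace α] {μ : Measure α} {w : α → ℂ} {s : ℝ}

theorem integrable_pow_succ (hw : Integrable w μ) (hs : ∀ᵐ t ∂μ, ‖w t‖ ≤ s) (j : ℕ) :
    Integrable (fun t => w t ^ (j + 1)) μ := by
  refine (hw.norm.const_mul (s ^ j)).mono' (hw.1.pow _) ?_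
  filter_upwards [hs] with t ht
  rw [norm_pow, pow_succ]
  gcongr

theorem integral_norm_pow_succ_le (hw : Integrable w μ) (hs : ∀ᵐ t ∂μ, ‖w t‖ ≤ s) (j : ℕ) :
    ∫ t, ‖w t ^ (j + 1)‖ ∂μ ≤ s ^ j * ∫ t, ‖w t‖ ∂μ := by
  rw [← integral_const_mul]
  refine integral_mono_ae (integrable_pow_succ hw hs j).norm (hw.norm.const_mul _) ?_
  filter_upwards [hs] with t ht
  rw [norm_pow, pow_succ]
  gcongr

/-- Away from the singularity `|log(1 - w)|` is at most a constant multiple of `|w|`. -/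
theorem integrable_log_one_sub (hw : Integrable w μ) (hs : ∀ᵐ t ∂μ, ‖w t‖ ≤ s) (hs1 : s < 1) :
    Integrable (fun t => Complex.log (1 - w t)) μ := by
  refine (hw.norm.const_mul (s * (1 - s)⁻¹ / 2 + 1)).mono'
    (Complex.measurable_log.comp_aemeasurable
      (hw.1.aemeasurable.const_sub 1)).aestronglyMeasurable ?_
  filter_upwards [hs] with t ht
  have h1 : ‖-w t‖ < 1 := by rw [norm_neg]; exact ht.trans_lt hs1
  have h2 := Complex.norm_log_one_add_le h1
  rw [← sub_eq_add_neg, norm_neg] at h2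
  refine h2.trans ?_
  have h3 : (1 - ‖w t‖)⁻¹ ≤ (1 - s)⁻¹ := inv_anti₀ (by linarith) (by linarith)
  have h0 : 0 ≤ s := (norm_nonneg _).trans ht
  have h4 : 0 ≤ (1 - s)⁻¹ := inv_nonneg.2 (by linarith)
  have h5 : ‖w t‖ ^ 2 * (1 - ‖w t‖)⁻¹ ≤ ‖w t‖ * s * (1 - s)⁻¹ := by
    rw [sq]
    exact mul_le_mul (by gcongr) h3 (inv_nonneg.2 (by linarith)) (by positivity)
  linarith

/-- The Taylor series of `-log(1 - w)` is integrated termwise; the `L¹` norms of its terms are at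
most `s^j ∫ |w|`. -/
theorem hasSum_integral_pow_succ_div (hw : Integrable w μ) (hs : ∀ᵐ t ∂μ, ‖w t‖ ≤ s)
    (hs0 : 0 ≤ s) (hs1 : s < 1) :
    HasSum (fun j : ℕ => (∫ t, w t ^ (j + 1) ∂μ) / ((j : ℂ) + 1))
      (-∫ t, Complex.log (1 - w t) ∂μ) := by
  have hi : ∀ j : ℕ, Integrable (fun t => w t ^ (j + 1) / ((j : ℂ) + 1)) μ := fun j =>
    (integrable_pow_succ hw hs j).div_const _
  have hsum : Summable fun j : ℕ => ∫ t, ‖w t ^ (j + 1) / ((j : ℂ) + 1)‖ ∂μ := by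
    refine Summable.of_nonneg_of_le (fun _ => integral_nonneg fun _ => norm_nonneg _)
      (fun j => ?_) ((summable_geometric_of_lt_one hs0 hs1).mul_right (∫ t, ‖w t‖ ∂μ))
    refine (integral_mono (hi j).norm (integrable_pow_succ hw hs j).norm fun t => ?_).trans
      (integral_norm_pow_succ_le hw hs j)
    simp only [norm_div]
    refine div_le_self (norm_nonneg _) ?_
    rw [← Nat.cast_succ, Complex.norm_natCast]
    exact_mod_cast Nat.succ_le_succ j.zero_le
  have h := hasSum_integral_of_summable_integral_norm hi hsum
  simp only [integral_div] at h
  suffices h' : -∫ t, Complex.log (1 - w t) ∂μ =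
      ∫ t, ∑' j : ℕ, w t ^ (j + 1) / ((j : ℂ) + 1) ∂μ by rw [h']; exact h
  rw [← integral_neg]
  refine integral_congr_ae ?_
  filter_upwards [hs] with t ht
  simpa using (Complex.hasSum_taylorSeries_neg_log' (ht.trans_lt hs1)).tsum_eq.symm

end PowerIntegrals

/-! ### Bounds from the sup norm -/

namespace TestFun

variable {d : ℕ}

theorem ae_norm_le_of_supNorm_lt {f : TestFun d} {r : ℝ≥0∞} (hr : r ≠ ∞) (h : f.supNorm < r) :
    ∀ᵐ t, ‖f t‖ ≤ f.supNorm.toReal := by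
  have h1 : ∀ᵐ t, ‖f t‖ₑ ≤ f.supNorm := by
    rw [supNorm, eLpNorm_exponent_top]; exact enorm_ae_le_eLpNormEssSup _ _
  filter_upwards [h1] with t ht
  rw [← toReal_enorm]
  exact ENNReal.toReal_mono (h.trans hr.lt_top).ne ht

theorem exists_bound {f g : TestFun d} (hf : f.supNorm < 1 / 2) (hg : g.supNorm < 1 / 2) :
    ∃ ρ : ℝ, 0 ≤ ρ ∧ ρ < 1 ∧ ∀ᵐ t, ‖4 * (conj (f t) * g t)‖ ≤ ρ := by
  have hne : (1 / 2 : ℝ≥0∞) ≠ ∞ := by simp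
  have hlt : ∀ x : ℝ≥0∞, x < 1 / 2 → x.toReal < 1 / 2 := fun x hx => by
    have := (ENNReal.toReal_lt_toReal (hx.trans hne.lt_top).ne hne).2 hx
    simpa using this
  refine ⟨4 * (f.supNorm.toReal * g.supNorm.toReal), by positivity, ?_, ?_⟩
  · have h1 := hlt _ hf
    have h2 := hlt _ hg
    have h3 : 0 ≤ f.supNorm.toReal := ENNReal.toReal_nonneg
    have h4 : 0 ≤ g.supNorm.toReal := ENNReal.toReal_nonneg
    nlinarith
  · filter_upwards [ae_norm_le_of_supNorm_lt hne hf, ae_norm_le_of_supNorm_lt hne hg] with t h1 h2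
    rw [norm_mul, norm_mul, RCLike.norm_conj, Complex.norm_ofNat]
    gcongr

theorem integrable_conj_mul (f g : TestFun d) : Integrable fun t => conj (f t) * g t :=
  f.2.1.star.integrable_mul g.2.1

end TestFun

/-! ### Convergence and inner products of exponential vectors -/

namespace FockRep

variable {d : ℕ} {c : ℝ} {H : Type*} [NormedAddCommGroup H] [InnerProductSpace ℂ H]
  (R : FockRep d c H)

theorem coef_recursion' (f g : TestFun d) (m : ℕ) :
    ((m : ℂ) + 1) * R.coef f g (m + 1) = ∑ j ∈ Finset.range (m + 1),
      (c / 2 * ∫ t, (4 * (conj (f t) * g t)) ^ (j + 1)) * R.coef f g (m - j) := by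
  rw [coef_recursion]
  refine Finset.sum_congr rfl fun j _ => ?_
  congr 1
  simp only [mul_pow (4 : ℂ), integral_const_mul]
  ring

theorem geomBound_kernel (c : ℝ) {f g : TestFun d} {ρ : ℝ}
    (h : ∀ᵐ t, ‖4 * (conj (f t) * g t)‖ ≤ ρ) :
    GeomBound ρ fun j => c / 2 * ∫ t, (4 * (conj (f t) * g t)) ^ (j + 1) := by
  refine ⟨‖(c / 2 : ℂ)‖ * ∫ t, ‖4 * (conj (f t) * g t)‖, fun j => ?_⟩
  rw [norm_mul, mul_assoc, mul_comm (∫ _, _)]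
  gcongr
  exact (norm_integral_le_integral_norm _).trans
    (integral_norm_pow_succ_le ((f.integrable_conj_mul g).const_mul 4) h j)

theorem exists_geomBound_coef {f g : TestFun d} (hf : f.supNorm < 1 / 2)
    (hg : g.supNorm < 1 / 2) : ∃ θ : ℝ, 0 < θ ∧ θ < 1 ∧ GeomBound θ (R.coef f g) := by
  obtain ⟨ρ, h0, h1, h⟩ := TestFun.exists_bound hf hg
  obtain ⟨θ, hθ, hθ1⟩ := exists_between h1
  exact ⟨θ, h0.trans_lt hθ, hθ1, (geomBound_kernel c h).of_recursion h0 hθ (R.coef_recursion' f g)⟩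

theorem tsum_coef {f g : TestFun d} (hf : f.supNorm < 1 / 2) (hg : g.supNorm < 1 / 2) :
    ∑' m, R.coef f g m =
      Complex.exp (-(c / 2) * ∫ t, Complex.log (1 - 4 * (conj (f t) * g t))) := by
  obtain ⟨ρ, h0, h1, h⟩ := TestFun.exists_bound hf hg
  rw [tsum_eq_exp_of_recursion (geomBound_kernel c h) h0 h1 (R.coef_zero f g)
    (R.coef_recursion' f g)]
  congr 1
  have hs := (hasSum_integral_pow_succ_div ((f.integrable_conj_mul g).const_mul 4) h h0
    h1).mul_left (c / 2 : ℂ)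
  simp only [← mul_div_assoc] at hs
  rw [hs.tsum_eq]; ring

theorem expTerm_eq (f : TestFun d) (m : ℕ) :
    R.expTerm f m = (R.vec f m : UniformSpace.Completion H) := rfl

theorem norm_expTerm_sq (f : TestFun d) (m : ℕ) : ‖R.expTerm f m‖ ^ 2 = ‖R.coef f f m‖ := by
  rw [expTerm_eq, UniformSpace.Completion.norm_coe, coef,
    inner_self_eq_norm_sq_to_K, norm_pow, RCLike.norm_ofReal, abs_norm]

/-- The squared norms of the terms are the coefficients for `f = g`, so the norms decay like `√θ ^
m`. -/
theorem expExists {f : TestFun d} (hf : f.supNorm < 1 / 2) : R.ExpExists f := by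
  obtain ⟨θ, h0, h1, M, hM⟩ := R.exists_geomBound_coef hf hf
  have hsq : √θ < 1 := by rw [Real.sqrt_lt' one_pos]; simpa using h1
  refine Summable.of_norm_bounded
    ((summable_geometric_of_lt_one (Real.sqrt_nonneg θ) hsq).mul_left √M) fun m => ?_
  have hM0 : 0 ≤ M := by simpa using (norm_nonneg _).trans (hM 0)
  refine (pow_le_pow_iff_left₀ (norm_nonneg _) (by positivity) two_ne_zero).1 ?_
  rw [norm_expTerm_sq, mul_pow, Real.sq_sqrt hM0, ← pow_mul, mul_comm m, pow_mul,
    Real.sq_sqrt h0.le]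
  exact hM m

theorem inner_expVec {f g : TestFun d} (hf : f.supNorm < 1 / 2) (hg : g.supNorm < 1 / 2) :
    inner ℂ (R.expVec f) (R.expVec g) = ∑' m, R.coef f g m := by
  have h1 : HasSum (fun n => inner ℂ (R.expVec f) (R.expTerm g n))
      (inner ℂ (R.expVec f) (R.expVec g)) :=
    (R.expExists hg).hasSum.mapL (innerSL ℂ (R.expVec f))
  rw [← h1.tsum_eq]
  refine tsum_congr fun n => ?_
  -- The series for `f` is expanded in the linear slot, hence the conjugations below.
  have h2 : HasSum (fun m => inner ℂ (R.expTerm g n) (R.expTerm f m))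
      (inner ℂ (R.expTerm g n) (R.expVec f)) :=
    (R.expExists hf).hasSum.mapL (innerSL ℂ (R.expTerm g n))
  rw [← inner_conj_symm, ← h2.tsum_eq, tsum_eq_single n fun m hm => by
    rw [expTerm_eq, expTerm_eq, UniformSpace.Completion.inner_coe, R.inner_vec_of_ne g f hm.symm]]
  rw [inner_conj_symm, expTerm_eq, expTerm_eq, UniformSpace.Completion.inner_coe, coef]

end FockRep

/-! ### The boson Fock form on a polynomial algebra -/

namespace Boson

open MvPolynomial
open scoped ComplexOrder

variable {σ : Type*} {E : Type*} [NormedAddCommGroup E] [InnerProductSpace ℂ E] (e : σ → E)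

/-- The annihilation operator of the vector `e i`. -/
def ann (i : σ) : Derivation ℂ (MvPolynomial σ ℂ) (MvPolynomial σ ℂ) :=
  mkDerivation ℂ fun j => C (inner ℂ (e i) (e j))

theorem ann_X (i j : σ) : ann e i (X j) = C (inner ℂ (e i) (e j)) := mkDerivation_X _ _ _

/-- A commutator of derivations is a derivation, hence determined by its values on the variables. -/
theorem derivation_commutator {D₁ D₂ D₃ : Derivation ℂ (MvPolynomial σ ℂ) (MvPolynomial σ ℂ)}
    (h : ∀ i, D₁ (D₂ (X i)) = D₂ (D₁ (X i)) + D₃ (X i)) (P : MvPolynomial σ ℂ) :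
    D₁ (D₂ P) = D₂ (D₁ P) + D₃ P := by
  have : ⁅D₁, D₂⁆ = D₃ := derivation_ext fun i => by
    rw [Derivation.commutator_apply, h, add_sub_cancel_left]
  rw [← this, Derivation.commutator_apply, add_sub_cancel]

theorem ann_comm (i j : σ) (P : MvPolynomial σ ℂ) :
    ann e i (ann e j P) = ann e j (ann e i P) := by
  have := derivation_commutator (D₁ := ann e i) (D₂ := ann e j) (D₃ := 0)
    (fun k => by simp [ann_X]) P
  simpa using this

/-- The endomorphisms of the polynomial algebra that are polynomials in the annihilators. -/
def annAlg : Subalgebra ℂ (Module.End ℂ (MvPolynomial σ ℂ)) :=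
  Algebra.adjoin ℂ (Set.range fun i => (ann e i : MvPolynomial σ ℂ →ₗ[ℂ] MvPolynomial σ ℂ))

/-- Commutativity is what permits substituting annihilators for the variables by `aeval`. -/
instance : IsMulCommutative (annAlg e) :=
  Algebra.isMulCommutative_adjoin ℂ (by
    rintro _ ⟨i, rfl⟩ _ ⟨j, rfl⟩
    exact LinearMap.ext fun P => ann_comm e i j P)

open scoped IsMulCommutative in
/-- The substitution of the annihilators for the variables. -/
def annHom : MvPolynomial σ ℂ →ₐ[ℂ] Module.End ℂ (MvPolynomial σ ℂ) :=
  (annAlg e).val.comp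
    (aeval fun i => (⟨ann e i, Algebra.subset_adjoin ⟨i, rfl⟩⟩ : annAlg e))

theorem annHom_X (i : σ) : annHom e (X i) = (ann e i : _ →ₗ[ℂ] _) := by
  simp [annHom]

/-- The sesquilinear form of the boson Fock space over the vectors `e i`. -/
def form : MvPolynomial σ ℂ →ₗ⋆[ℂ] MvPolynomial σ ℂ →ₗ[ℂ] ℂ :=
  LinearMap.mk₂'ₛₗ (starRingEnd ℂ) (RingHom.id ℂ)
    (fun P Q => constantCoeff (annHom e (map (starRingEnd ℂ) P) Q))
    (fun P P' Q => by simp)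
    (fun a P Q => by
      rw [smul_eq_C_mul, map_mul, map_C, ← smul_eq_C_mul]
      simp)
    (fun P Q Q' => by simp)
    (fun a P Q => by simp)

theorem form_apply (P Q : MvPolynomial σ ℂ) :
    form e P Q = constantCoeff (annHom e (map (starRingEnd ℂ) P) Q) := rfl

theorem form_C (a : ℂ) (Q : MvPolynomial σ ℂ) : form e (C a) Q = conj a * constantCoeff Q := by
  rw [← mul_one (C a), ← smul_eq_C_mul, LinearMap.map_smulₛₗ, LinearMap.smul_apply, form_apply]
  simp

theorem form_X_mul (i : σ) (P Q : MvPolynomial σ ℂ) :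
    form e (X i * P) Q = form e P (ann e i Q) := by
  rw [form_apply, form_apply, mul_comm, map_mul, map_X, map_mul, annHom_X, Module.End.mul_apply]
  rfl

/-- The other half of the adjointness, which is not built into the definition: by induction on `P`,
both sides pick up the canonical commutator `⟨e i, e j⟩`. -/
theorem form_ann (i : σ) (P Q : MvPolynomial σ ℂ) :
    form e (ann e i P) Q = form e P (X i * Q) := by
  induction P using MvPolynomial.induction_on generalizing Q with
  | C a => rw [derivation_C, form_C]; simp
  | add P P' h h' => simp only [map_add, LinearMap.add_apply, h, h']
  | mul_X P j h =>
    rw [mul_comm P, Derivation.leibniz, form_X_mul, Derivation.leibniz, ann_X, ann_X,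
      smul_eq_mul, smul_eq_mul, smul_eq_mul, smul_eq_mul, map_add, map_add, LinearMap.add_apply,
      form_X_mul, h, mul_comm P, mul_comm Q, ← smul_eq_C_mul, ← smul_eq_C_mul,
      LinearMap.map_smulₛₗ, LinearMap.smul_apply, map_smul, inner_conj_symm]

theorem form_one_right (P : MvPolynomial σ ℂ) : form e P 1 = conj (constantCoeff P) := by
  induction P using MvPolynomial.induction_on with
  | C a => rw [form_C]; simp
  | add P P' h h' => simp only [map_add, LinearMap.add_apply, h, h']
  | mul_X P j h => rw [mul_comm P, form_X_mul]; simp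

theorem conj_form (P Q : MvPolynomial σ ℂ) : conj (form e Q P) = form e P Q := by
  induction P using MvPolynomial.induction_on generalizing Q with
  | C a =>
    rw [form_C, ← mul_one (C a), ← smul_eq_C_mul, map_smul, form_one_right]; simp
  | add P P' h h' => simp only [map_add, LinearMap.add_apply, h, h']
  | mul_X P j h => rw [mul_comm P, form_X_mul, ← form_ann, h]

/-- The derivation with `X i ↦ t i * X (τ i)`. -/
def shift (t : σ → ℝ) (τ : σ → σ) : Derivation ℂ (MvPolynomial σ ℂ) (MvPolynomial σ ℂ) :=
  mkDerivation ℂ fun i => (t i : ℂ) • X (τ i)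

theorem shift_X (t : σ → ℝ) (τ : σ → σ) (i : σ) : shift t τ (X i) = (t i : ℂ) • X (τ i) :=
  mkDerivation_X _ _ _

theorem constantCoeff_shift (t : σ → ℝ) (τ : σ → σ) (P : MvPolynomial σ ℂ) :
    constantCoeff (shift t τ P) = 0 := by
  induction P using MvPolynomial.induction_on with
  | C a => simp
  | add P P' h h' => simp only [map_add, h, h', add_zero]
  | mul_X P j h => rw [Derivation.leibniz, shift_X]; simp [h]

/-- `H` says that the one-particle maps are adjoint, and second quantisation preserves this: the
commutator of `ann e i` with one shift is annihilation of the vector moved by the other. -/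
theorem form_shift {t t' : σ → ℝ} {τ τ' : σ → σ}
    (H : ∀ i j, t j * inner ℂ (e i) (e (τ j)) = t' i * inner ℂ (e (τ' i)) (e j))
    (P Q : MvPolynomial σ ℂ) : form e (shift t' τ' P) Q = form e P (shift t τ Q) := by
  induction P using MvPolynomial.induction_on generalizing Q with
  | C a => rw [derivation_C, form_C, constantCoeff_shift]; simp
  | add P P' h h' => simp only [map_add, LinearMap.add_apply, h, h']
  | mul_X P i h =>
    have key := derivation_commutator (D₁ := ann e i) (D₂ := shift t τ)
      (D₃ := (t' i : ℂ) • ann e (τ' i)) (fun j => by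
        rw [shift_X, Derivation.map_smul, ann_X, ann_X, derivation_C, zero_add, Derivation.smul_apply, ann_X,
          smul_eq_C_mul, smul_eq_C_mul, ← C_mul, ← C_mul, H]) Q
    rw [mul_comm P, form_X_mul, key, Derivation.leibniz, shift_X, map_add, LinearMap.add_apply,
      smul_eq_mul, smul_eq_mul, form_X_mul, h, mul_smul_comm, LinearMap.map_smulₛₗ,
      LinearMap.smul_apply, mul_comm P, form_X_mul, map_add, Derivation.smul_apply, map_smul,
      Complex.conj_ofReal]

theorem derivation_sum_apply {ι : Type*} (s : Finset ι)
    (D : ι → Derivation ℂ (MvPolynomial σ ℂ) (MvPolynomial σ ℂ)) (P : MvPolynomial σ ℂ) :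
    (∑ i ∈ s, D i) P = ∑ i ∈ s, D i P := by
  have := congrFun (map_sum (Derivation.coeFnAddMonoidHom (R := ℂ) (A := MvPolynomial σ ℂ)
    (M := MvPolynomial σ ℂ)) D s) P
  exact this.trans (by rw [Finset.sum_apply]; rfl)

/-- The Euler operator; the sum runs over `P.vars` because `σ` may be infinite. -/
theorem shift_one_id_eq_sum (P : MvPolynomial σ ℂ) :
    shift 1 id P = ∑ i ∈ P.vars, X i * pderiv i P := by
  classical
  have : shift 1 id P = (∑ i ∈ P.vars, (X i : MvPolynomial σ ℂ) • pderiv i) P := by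
    refine derivation_eq_of_forall_mem_vars fun j hj => ?_
    rw [shift_X, derivation_sum_apply, Finset.sum_eq_single j]
    · simp
    · intro i _ hij; simp [pderiv_X, hij.symm]
    · exact fun h => absurd hj h
  rw [this, derivation_sum_apply]
  rfl

theorem shift_one_id_of_isHomogeneous {P : MvPolynomial σ ℂ} {n : ℕ} (hP : P.IsHomogeneous n) :
    shift 1 id P = (n : ℂ) • P := by
  conv_lhs => rw [P.as_sum]
  conv_rhs => rw [P.as_sum]
  rw [map_sum, Finset.smul_sum]
  refine Finset.sum_congr rfl fun m hm => ?_
  have hc := mem_support_iff.1 hm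
  have hd : m.degree = n := by
    rw [Finsupp.degree_eq_weight_one]; exact hP hc
  rw [shift_one_id_eq_sum, vars_monomial hc]
  simp only [X_mul_pderiv_monomial]
  rw [← Finset.sum_smul, ← Nat.cast_smul_eq_nsmul ℂ, ← hd]
  rfl

theorem ann_eq_sum (i : σ) (P : MvPolynomial σ ℂ) :
    ann e i P = ∑ j ∈ P.vars, inner ℂ (e i) (e j) • pderiv j P := by
  classical
  have : ann e i P = (∑ j ∈ P.vars, inner ℂ (e i) (e j) • pderiv j) P := by
    refine derivation_eq_of_forall_mem_vars fun j hj => ?_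
    rw [ann_X, derivation_sum_apply, Finset.sum_eq_single j]
    · simp [smul_eq_C_mul]
    · intro k _ hkj; simp [pderiv_X, hkj.symm]
    · exact fun h => absurd hj h
  rw [this, derivation_sum_apply]
  rfl

/-- The Euler operator is symmetric for the form, and the degrees are its eigenvalues. -/
theorem form_of_isHomogeneous_ne {P Q : MvPolynomial σ ℂ} {m n : ℕ} (hP : P.IsHomogeneous m)
    (hQ : Q.IsHomogeneous n) (h : m ≠ n) : form e P Q = 0 := by
  have key := form_shift e (t := 1) (t' := 1) (τ := id) (τ' := id) (fun i j => by simp) P Q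
  rw [shift_one_id_of_isHomogeneous hP, shift_one_id_of_isHomogeneous hQ, LinearMap.map_smulₛₗ,
    map_smul, LinearMap.smul_apply, smul_eq_mul, smul_eq_mul, Complex.conj_natCast] at key
  have h2 : ((m : ℂ) - n) * form e P Q = 0 := by rw [sub_mul, key, sub_self]
  exact (mul_eq_zero.1 h2).resolve_left (sub_ne_zero.2 (Nat.cast_injective.ne h))

theorem exists_factorization (s : Finset σ) : ∃ (k : ℕ) (B : Fin k → σ → ℂ),
    ∀ i ∈ s, ∀ j ∈ s, inner ℂ (e i) (e j) = ∑ l, conj (B l i) * B l j := by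
  classical
  let V := Submodule.span ℂ ((s.image e : Finset E) : Set E)
  let b := stdOrthonormalBasis ℂ V
  have hV : ∀ i ∈ s, e i ∈ V := fun i hi =>
    Submodule.subset_span (Finset.mem_coe.2 (Finset.mem_image_of_mem e hi))
  refine ⟨_, fun l i => inner ℂ (b l : E) (e i), fun i hi j hj => ?_⟩
  have := b.sum_inner_mul_inner ⟨e i, hV i hi⟩ ⟨e j, hV j hj⟩
  simp only [Submodule.coe_inner] at this
  simp only [← this, inner_conj_symm]

/-- Euler's identity gives `(n+1)⟨P,P⟩ = ∑ ⟨e i, e j⟩ ⟨∂_i P, ∂_j P⟩`. Factoring the Gram matrix as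
`B^* B` turns this into a sum of values `⟨R,R⟩` with `R` homogeneous of degree `n`. -/
theorem form_self_nonneg_of_isHomogeneous {P : MvPolynomial σ ℂ} {n : ℕ}
    (hP : P.IsHomogeneous n) : 0 ≤ form e P P := by
  classical
  induction n generalizing P with
  | zero =>
    rw [← totalDegree_zero_iff_isHomogeneous, totalDegree_eq_zero_iff_eq_C] at hP
    rw [hP, form_C, constantCoeff_C, mul_comm, Complex.mul_conj]
    exact_mod_cast Complex.normSq_nonneg _
  | succ n ih =>
    obtain ⟨k, B, hB⟩ := exists_factorization e P.vars
    have h1 : ((n + 1 : ℕ) : ℂ) * form e P P =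
        ∑ l, form e (∑ i ∈ P.vars, B l i • pderiv i P) (∑ i ∈ P.vars, B l i • pderiv i P) := by
      have : ((n + 1 : ℕ) : ℂ) * form e P P = form e (shift 1 id P) P := by
        rw [shift_one_id_of_isHomogeneous hP, LinearMap.map_smulₛₗ, LinearMap.smul_apply,
          smul_eq_mul, Complex.conj_natCast]
      have hl : ∀ l, form e (∑ i ∈ P.vars, B l i • pderiv i P) (∑ i ∈ P.vars, B l i • pderiv i P) =
          ∑ i ∈ P.vars, ∑ j ∈ P.vars,
            conj (B l i) * B l j * form e (pderiv i P) (pderiv j P) := fun l => by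
        rw [map_sum, Finset.sum_comm]
        refine Finset.sum_congr rfl fun j _ => ?_
        rw [map_sum, LinearMap.sum_apply]
        refine Finset.sum_congr rfl fun i _ => ?_
        rw [map_smul, LinearMap.map_smulₛₗ, LinearMap.smul_apply, smul_eq_mul, smul_eq_mul]
        ring
      rw [this, shift_one_id_eq_sum, map_sum, LinearMap.sum_apply,
        Finset.sum_congr rfl fun l _ => hl l, Finset.sum_comm]
      refine Finset.sum_congr rfl fun i hi => ?_
      rw [form_X_mul, ann_eq_sum, map_sum, Finset.sum_comm]
      refine Finset.sum_congr rfl fun j hj => ?_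
      rw [map_smul, hB i hi j hj, smul_eq_mul, Finset.sum_mul]
    have h2 : 0 ≤ ((n + 1 : ℕ) : ℂ) * form e P P := by
      rw [h1]
      refine Finset.sum_nonneg fun l _ => ih ?_
      refine IsHomogeneous.sum _ _ _ fun i _ => ?_
      rw [smul_eq_C_mul]
      exact hP.pderiv.C_mul (B l i)
    have h3 : (0 : ℂ) ≤ (((n + 1 : ℕ) : ℝ)⁻¹ : ℝ) := Complex.zero_le_real.2 (by positivity)
    have h4 := mul_nonneg h3 h2
    rwa [Complex.ofReal_inv, Complex.ofReal_natCast,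
      inv_mul_cancel_left₀ (Nat.cast_ne_zero.2 n.succ_ne_zero)] at h4

theorem form_self_nonneg (P : MvPolynomial σ ℂ) : 0 ≤ form e P P := by
  have : form e P P = ∑ n ∈ Finset.range (P.totalDegree + 1),
      form e (homogeneousComponent n P) (homogeneousComponent n P) := by
    conv_lhs => rw [← sum_homogeneousComponent P]
    rw [map_sum]
    refine Finset.sum_congr rfl fun m hm => ?_
    rw [map_sum, LinearMap.sum_apply]
    refine Finset.sum_eq_single m (fun n _ hnm => ?_) fun h => absurd hm h
    exact form_of_isHomogeneous_ne e (homogeneousComponent_isHomogeneous _ _)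
      (homogeneousComponent_isHomogeneous _ _) hnm
  rw [this]
  exact Finset.sum_nonneg fun n _ =>
    form_self_nonneg_of_isHomogeneous e (homogeneousComponent_isHomogeneous _ _)

end Boson

/-! ### Operators on the boson Fock space over the layers -/

namespace Model

open MvPolynomial Boson
open scoped ComplexOrder

variable (d : ℕ) (c : ℝ)

/-- The one-particle space: countably many copies of `L²`. -/
abbrev OneParticle : Type :=
  lp (fun _ : ℕ => Lp ℂ 2 (volume : Measure (EuclideanSpace ℝ (Fin d)))) 2

/-- The polynomials in the creation operators of the vectors `u` of the layers `n`. -/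
abbrev Poly : Type := MvPolynomial (ℕ × TestFun d) ℂ

variable {d}

/-- The vector `u` of the layer `n`, with its normalisation. -/
def layer (p : ℕ × TestFun d) : OneParticle d :=
  lp.single 2 p.1 ((√(2 * c * (p.1 + 1)) : ℂ) • p.2.2.1.toLp p.2)

theorem inner_layer (hc : 0 < c) (p q : ℕ × TestFun d) : inner ℂ (layer c p) (layer c q) =
    if p.1 = q.1 then 2 * c * (p.1 + 1) * TestFun.l2inner p.2 q.2 else 0 := by
  have hL : inner ℂ (p.2.2.1.toLp p.2) (q.2.2.1.toLp q.2) = TestFun.l2inner p.2 q.2 := by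
    rw [L2.inner_def, TestFun.l2inner]
    refine integral_congr_ae ?_
    filter_upwards [p.2.2.1.coeFn_toLp, q.2.2.1.coeFn_toLp] with t h1 h2
    rw [h1, h2, RCLike.inner_apply, mul_comm]
  rw [layer, layer, lp.inner_single_left]
  split_ifs with h
  · rw [h, lp.single_apply_self, inner_smul_left, inner_smul_right, hL, Complex.conj_ofReal,
      ← mul_assoc, ← Complex.ofReal_mul, Real.mul_self_sqrt (by positivity)]
    push_cast; rfl
  · rw [lp.single_apply_ne _ _ _ h, inner_zero_right]

/-- Raising the layer and multiplying by `h`. -/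
def up (h : TestFun d) : Derivation ℂ (Poly d) (Poly d) :=
  shift (fun p => 2 * (p.1 + 1)) fun p => (p.1 + 1, h * p.2)

/-- Lowering the layer and multiplying by the conjugate of `h`. -/
def down (h : TestFun d) : Derivation ℂ (Poly d) (Poly d) :=
  -- Truncated subtraction would keep layer `0` in place; the zero coefficient kills it instead.
  shift (fun p => if p.1 = 0 then 0 else 2 * (p.1 + 1)) fun p => (p.1 - 1, star h * p.2)

/-- The operator of `N_h`. -/
def num (h : TestFun d) : Derivation ℂ (Poly d) (Poly d) :=
  shift (fun p => 2 * (p.1 + 1)) fun p => (p.1, h * p.2)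

/-- The operator of `B_h`. -/
def lower (h : TestFun d) : Derivation ℂ (Poly d) (Poly d) := ann (layer c) (0, h) + down h

/-- The operator of `B_h^*`. -/
def raise (h : TestFun d) : Module.End ℂ (Poly d) :=
  LinearMap.mulLeft ℂ (X (0, h)) + (up h : Poly d →ₗ[ℂ] Poly d)

variable {c}

theorem raise_apply (h : TestFun d) (P : Poly d) : raise h P = X (0, h) * P + up h P := rfl

theorem up_X (h u : TestFun d) (n : ℕ) :
    up h (X (n, u)) = (2 * (n + 1) : ℂ) • X (n + 1, h * u) := by
  rw [up, shift_X]; push_cast; rfl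

theorem num_X (h u : TestFun d) (n : ℕ) :
    num h (X (n, u)) = (2 * (n + 1) : ℂ) • X (n, h * u) := by
  rw [num, shift_X]; push_cast; rfl

theorem lower_X_zero (hc : 0 < c) (h u : TestFun d) :
    lower c h (X (0, u)) = C (2 * c * TestFun.l2inner h u) := by
  rw [lower, Derivation.add_apply, ann_X, down, shift_X, inner_layer c hc]; simp

theorem lower_X_succ (hc : 0 < c) (h u : TestFun d) (n : ℕ) :
    lower c h (X (n + 1, u)) = (2 * (n + 2) : ℂ) • X (n, star h * u) := by
  rw [lower, Derivation.add_apply, ann_X, down, shift_X, inner_layer c hc]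
  simp only [(Nat.succ_ne_zero n).symm, Nat.succ_ne_zero, if_false, map_zero, zero_add,
    Nat.add_sub_cancel]
  push_cast
  ring_nf

theorem lower_C (h : TestFun d) (a : ℂ) : lower c h (C a) = 0 := derivation_C _ _

/-- On layer `n` the `sl₂` relation is `2(n+1)·2(n+2) - 2n·2(n+1) = 4·2(n+1)`; the scalar comes from
`lower` hitting the factor `X (0, g)`. -/
theorem lower_raise (hc : 0 < c) (f g : TestFun d) (P : Poly d) :
    lower c f (raise g P) = raise g (lower c f P) + (2 * c * TestFun.l2inner f g) • P
      + (4 : ℂ) • num (star f * g) P := by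
  have key := derivation_commutator (D₁ := lower c f) (D₂ := up g)
    (D₃ := (4 : ℂ) • num (star f * g)) (fun ⟨n, u⟩ => by
      rw [up_X, Derivation.map_smul, lower_X_succ hc, Derivation.smul_apply, num_X,
        ← TestFun.mul_assoc']
      cases n with
      | zero =>
        rw [lower_X_zero hc, derivation_C, zero_add]
        simp only [smul_smul]; congr 1; push_cast; ring
      | succ n =>
        rw [lower_X_succ hc, Derivation.map_smul, up_X, ← TestFun.mul_assoc',
          TestFun.mul_comm' g (star f)]
        simp only [smul_smul, ← add_smul]; congr 1; push_cast; ring) P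
  rw [raise_apply, raise_apply, map_add, Derivation.leibniz, lower_X_zero hc, key, smul_eq_mul,
    smul_eq_mul, Derivation.smul_apply, smul_eq_C_mul (a := 2 * c * TestFun.l2inner f g)]
  ring

theorem num_raise (f g : TestFun d) (P : Poly d) :
    num f (raise g P) = raise g (num f P) + (2 : ℂ) • raise (f * g) P := by
  have key := derivation_commutator (D₁ := num f) (D₂ := up g)
    (D₃ := (2 : ℂ) • up (f * g)) (fun ⟨n, u⟩ => by
      rw [up_X, Derivation.map_smul, num_X, Derivation.smul_apply, up_X, num_X,
        Derivation.map_smul, up_X, ← TestFun.mul_assoc', ← TestFun.mul_assoc',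
        TestFun.mul_comm' g f]
      simp only [smul_smul, ← add_smul]; congr 1; push_cast; ring) P
  rw [raise_apply, raise_apply, raise_apply, map_add, Derivation.leibniz, num_X, key,
    smul_eq_mul, smul_eq_mul, Derivation.smul_apply, smul_add, mul_smul_comm, mul_comm P]
  simp only [Nat.cast_zero, zero_add, mul_one]
  ring

theorem lower_num (hc : 0 < c) (f g : TestFun d) (P : Poly d) :
    lower c g (num (star f) P) = num (star f) (lower c g P) + (2 : ℂ) • lower c (f * g) P := by
  refine derivation_commutator (D₁ := lower c g) (D₂ := num (star f))
    (D₃ := (2 : ℂ) • lower c (f * g)) (fun ⟨n, u⟩ => ?_) P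
  rw [num_X, Derivation.map_smul, Derivation.smul_apply]
  cases n with
  | zero =>
    have : TestFun.l2inner g (star f * u) = TestFun.l2inner (f * g) u :=
      (TestFun.l2inner_mul_left g u f).symm
    rw [lower_X_zero hc, lower_X_zero hc, lower_X_zero hc, derivation_C, this]
    simp
  | succ n =>
    rw [lower_X_succ hc, lower_X_succ hc, lower_X_succ hc, Derivation.map_smul, num_X,
      TestFun.star_mul', ← TestFun.mul_assoc', ← TestFun.mul_assoc',
      TestFun.mul_comm' (star g)]
    simp only [smul_smul, ← add_smul]; congr 1; push_cast; ring

theorem lower_lower (hc : 0 < c) (f g : TestFun d) (P : Poly d) :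
    lower c f (lower c g P) = lower c g (lower c f P) := by
  have := derivation_commutator (D₁ := lower c f) (D₂ := lower c g) (D₃ := 0)
    (fun ⟨n, u⟩ => by
      rw [Derivation.zero_apply, add_zero]
      match n with
      | 0 => rw [lower_X_zero hc, lower_X_zero hc, lower_C, lower_C]
      | 1 =>
        rw [lower_X_succ hc, lower_X_succ hc, Derivation.map_smul, Derivation.map_smul,
          lower_X_zero hc, lower_X_zero hc, ← TestFun.l2inner_mul_left,
          ← TestFun.l2inner_mul_left, TestFun.mul_comm']
      | n + 2 =>
        rw [lower_X_succ hc, lower_X_succ hc, Derivation.map_smul, Derivation.map_smul,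
          lower_X_succ hc, lower_X_succ hc, ← TestFun.mul_assoc', ← TestFun.mul_assoc',
          TestFun.mul_comm' (star f)]) P
  simpa using this

theorem raise_raise (f g : TestFun d) (P : Poly d) :
    raise f (raise g P) = raise g (raise f P) := by
  have key := derivation_commutator (D₁ := up f) (D₂ := up g) (D₃ := 0)
    (fun ⟨n, u⟩ => by
      rw [Derivation.zero_apply, add_zero, up_X, up_X, Derivation.map_smul, Derivation.map_smul,
        up_X, up_X, ← TestFun.mul_assoc', ← TestFun.mul_assoc', TestFun.mul_comm' f]) P
  rw [Derivation.zero_apply, add_zero] at key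
  rw [raise_apply, raise_apply, raise_apply, raise_apply, map_add, map_add, Derivation.leibniz,
    Derivation.leibniz, up_X, up_X, key, TestFun.mul_comm' f, smul_eq_mul, smul_eq_mul]
  ring

theorem num_num (f g : TestFun d) (P : Poly d) : num f (num g P) = num g (num f P) := by
  have := derivation_commutator (D₁ := num f) (D₂ := num g) (D₃ := 0)
    (fun ⟨n, u⟩ => by
      rw [Derivation.zero_apply, add_zero, num_X, num_X, Derivation.map_smul,
        Derivation.map_smul, num_X, num_X, ← TestFun.mul_assoc', ← TestFun.mul_assoc',
        TestFun.mul_comm' f]) P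
  simpa using this

/-- The layer weights `2c(n+1)` make `up` and `down` adjoint: `2(n+1)·2c(n+2) = 2(n+2)·2c(n+1)`. -/
theorem form_lower (hc : 0 < c) (h : TestFun d) (P Q : Poly d) :
    form (layer c) (lower c h P) Q = form (layer c) P (raise h Q) := by
  have key := form_shift (layer c) (t := fun p => 2 * ((p.1 : ℝ) + 1))
    (τ := fun p => (p.1 + 1, h * p.2))
    (t' := fun p => if p.1 = 0 then 0 else 2 * ((p.1 : ℝ) + 1))
    (τ' := fun p => (p.1 - 1, star h * p.2)) (fun ⟨n, u⟩ ⟨m, v⟩ => by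
      simp only [inner_layer c hc]
      rw [TestFun.l2inner_mul_left, TestFun.star_star']
      rcases n with _ | n
      · simp
      · by_cases hnm : n = m
        · subst hnm; simp; ring
        · simp [hnm]) P Q
  rw [raise_apply, map_add, ← form_ann, lower, Derivation.add_apply, map_add,
    LinearMap.add_apply]
  exact congrArg _ key

theorem form_raise (hc : 0 < c) (h : TestFun d) (P Q : Poly d) :
    form (layer c) (raise h P) Q = form (layer c) P (lower c h Q) := by
  rw [← conj_form, ← form_lower hc, conj_form]

theorem form_num (hc : 0 < c) (h : TestFun d) (P Q : Poly d) :
    form (layer c) (num (star h) P) Q = form (layer c) P (num h Q) :=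
  form_shift (layer c) (fun ⟨n, u⟩ ⟨m, v⟩ => by
    simp only [inner_layer c hc]
    rw [TestFun.l2inner_mul_left, TestFun.star_star']
    by_cases hnm : n = m
    · subst hnm; simp
    · simp [hnm]) P Q

/-! ### The representation of the algebra on polynomials -/

variable (d c)

/-- The operators of the letters. -/
def letterOp : Symb d × Bool → Module.End ℂ (Poly d)
  | (.B f, false) => (lower c f : Poly d →ₗ[ℂ] Poly d)
  | (.B f, true) => raise f
  | (.N f, false) => (num f : Poly d →ₗ[ℂ] Poly d)
  | (.N f, true) => (num (star f) : Poly d →ₗ[ℂ] Poly d)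

/-- The representation of the free algebra on the polynomials. -/
def freeRep : FreeStarAlgebra (Symb d) →ₐ[ℂ] Module.End ℂ (Poly d) :=
  FreeAlgebra.lift ℂ (letterOp d c)

variable {d c}

theorem freeRep_letter (p : Symb d × Bool) : freeRep d c (.letter p) = letterOp d c p :=
  FreeAlgebra.lift_ι_apply _ _

theorem star_letter (p : Symb d × Bool) :
    star (FreeStarAlgebra.letter p) = FreeStarAlgebra.letter (p.1, !p.2) :=
  congrArg MulOpposite.unop (FreeStarAlgebra.starHom_letter p)

theorem freeRep_of_B (f : TestFun d) :
    freeRep d c (.of (.B f)) = (lower c f : Poly d →ₗ[ℂ] Poly d) := freeRep_letter _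

theorem freeRep_of_N (f : TestFun d) :
    freeRep d c (.of (.N f)) = (num f : Poly d →ₗ[ℂ] Poly d) := freeRep_letter _

theorem freeRep_star_B (f : TestFun d) : freeRep d c (star (.of (.B f))) = raise f := by
  rw [FreeStarAlgebra.of, star_letter, freeRep_letter]; rfl

theorem freeRep_star_N (f : TestFun d) :
    freeRep d c (star (.of (.N f))) = (num (star f) : Poly d →ₗ[ℂ] Poly d) := by
  rw [FreeStarAlgebra.of, star_letter, freeRep_letter]; rfl

theorem form_freeRep (hc : 0 < c) (a : FreeStarAlgebra (Symb d)) (P Q : Poly d) :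
    form (layer c) (freeRep d c a P) Q = form (layer c) P (freeRep d c (star a) Q) := by
  induction a using FreeStarAlgebra.induction generalizing P Q with
  | hz z =>
    rw [FreeStarAlgebra.star_algebraMap, AlgHom.commutes, AlgHom.commutes,
      Module.algebraMap_end_apply, Module.algebraMap_end_apply, LinearMap.map_smulₛₗ, map_smul,
      LinearMap.smul_apply]
  | hl p =>
    rw [star_letter, freeRep_letter, freeRep_letter]
    match p with
    | (.B f, false) => exact form_lower hc f P Q
    | (.B f, true) => exact form_raise hc f P Q
    | (.N f, false) =>
      have := form_num hc (star f) P Q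
      rwa [TestFun.star_star'] at this
    | (.N f, true) => exact form_num hc f P Q
  | hm a b ha hb =>
    rw [star_mul, map_mul, map_mul, Module.End.mul_apply, Module.End.mul_apply, ha, hb]
  | ha a b ha hb =>
    rw [star_add, map_add, map_add, LinearMap.add_apply, LinearMap.add_apply, map_add, map_add,
      LinearMap.add_apply, ha, hb]

/-- Proving each relation together with its adjoint makes the `adjoint` constructor a mere swap. -/
theorem freeRep_rel (hc : 0 < c) {a b : FreeStarAlgebra (Symb d)} (h : Rel d c a b) :
    freeRep d c a = freeRep d c b ∧ freeRep d c (star a) = freeRep d c (star b) := by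
  induction h with
  | B_Bstar f g =>
    have hz : conj (2 * c * TestFun.l2inner f g) = 2 * c * TestFun.l2inner g f := by
      rw [map_mul, TestFun.conj_l2inner, map_mul, Complex.conj_ofReal, map_ofNat]
    have hN : star (star f * g) = star g * f := by
      rw [TestFun.star_mul', TestFun.star_star', TestFun.mul_comm']
    constructor
    · refine LinearMap.ext fun P => ?_
      have h := lower_raise hc f g P
      generalize 2 * (c : ℂ) * TestFun.l2inner f g = z at h ⊢
      simp only [map_sub, map_mul, map_add, freeRep_of_B, freeRep_star_B, AlgHom.commutes,
        map_smul, freeRep_of_N]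
      rw [LinearMap.sub_apply, sub_eq_iff_eq_add']
      exact h.trans (add_assoc _ _ _)
    · refine LinearMap.ext fun P => ?_
      have h := lower_raise hc g f P
      simp only [star_add, FreeStarAlgebra.star_algebraMap, hz, star_smul]
      generalize 2 * (c : ℂ) * TestFun.l2inner g f = z at h ⊢
      simp only [star_sub, star_mul, star_star, map_sub, map_mul, map_add, freeRep_of_B,
        freeRep_star_B, AlgHom.commutes, map_smul, freeRep_star_N, hN, star_ofNat]
      rw [LinearMap.sub_apply, sub_eq_iff_eq_add']
      exact h.trans (add_assoc _ _ _)
  | N_Bstar f g =>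
    constructor
    · refine LinearMap.ext fun P => ?_
      simp only [map_sub, map_mul, freeRep_of_N, freeRep_star_B, map_smul]
      rw [LinearMap.sub_apply, sub_eq_iff_eq_add']
      exact num_raise f g P
    · refine LinearMap.ext fun P => ?_
      simp only [star_sub, star_mul, star_star, star_smul, map_sub, map_mul, freeRep_of_B,
        freeRep_star_N, map_smul, star_ofNat]
      rw [LinearMap.sub_apply, sub_eq_iff_eq_add']
      exact lower_num hc f g P
  | B_B f g =>
    constructor
    · simp only [map_sub, map_mul, freeRep_of_B, map_zero, sub_eq_zero]
      exact LinearMap.ext (lower_lower hc f g)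
    · simp only [star_sub, star_mul, star_zero, map_sub, map_mul, freeRep_star_B, map_zero,
        sub_eq_zero]
      exact LinearMap.ext (raise_raise g f)
  | N_N f g =>
    constructor
    · simp only [map_sub, map_mul, freeRep_of_N, map_zero, sub_eq_zero]
      exact LinearMap.ext (num_num f g)
    · simp only [star_sub, star_mul, star_zero, map_sub, map_mul, freeRep_star_N, map_zero,
        sub_eq_zero]
      exact LinearMap.ext (num_num _ _)
  | N_star f =>
    rw [star_star, freeRep_star_N, freeRep_of_N, freeRep_star_N, freeRep_of_N,
      TestFun.star_star']
    exact ⟨rfl, rfl⟩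
  | adjoint _ ih => rw [star_star, star_star]; exact ih.symm

/-- The representation of the algebra on the polynomials. -/
def rep (hc : 0 < c) : Alg d c →ₐ[ℂ] Module.End ℂ (Poly d) :=
  RingQuot.liftAlgHom ℂ ⟨freeRep d c, fun _ _ h => (freeRep_rel hc h).1⟩

theorem rep_mk (hc : 0 < c) (a : FreeStarAlgebra (Symb d)) :
    rep hc (Alg.mk d c a) = freeRep d c a :=
  RingQuot.liftAlgHom_mkAlgHom_apply ℂ _ _ _

theorem form_rep (hc : 0 < c) (a : Alg d c) (P Q : Poly d) :
    form (layer c) (rep hc a P) Q = form (layer c) P (rep hc (star a) Q) := by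
  obtain ⟨a, rfl⟩ := Alg.mk_surjective a
  rw [← Alg.mk_star, rep_mk, rep_mk, form_freeRep hc]

/-- The inner product of the Gelfand–Naimark–Segal construction for the vacuum state. -/
@[reducible]
def gnsCore (hc : 0 < c) : PreInnerProductSpace.Core ℂ (Alg d c) where
  inner a b := form (layer c) (rep hc a 1) (rep hc b 1)
  conj_inner_symm a b := conj_form _ _ _
  re_inner_nonneg a := (Complex.nonneg_iff.1 (form_self_nonneg (layer c) (rep hc a 1))).1
  add_left a b x := by
    rw [map_add, LinearMap.add_apply, map_add, LinearMap.add_apply]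
  smul_left a b z := by
    rw [map_smul, LinearMap.smul_apply, LinearMap.map_smulₛₗ, LinearMap.smul_apply, smul_eq_mul]

end Model

/-! ### The GNS construction -/

theorem exists_fockRep (d : ℕ) {c : ℝ} (hc : 0 < c) :
    ∃ (H : Type) (_ : NormedAddCommGroup H) (_ : InnerProductSpace ℂ H),
      Nonempty (FockRep d c H) := by
  let := Model.gnsCore (d := d) hc
  let _ : SeminormedAddCommGroup (Alg d c) :=
    InnerProductSpace.Core.toSeminormedAddCommGroup (𝕜 := ℂ)
  let _ : InnerProductSpace ℂ (Alg d c) := InnerProductSpace.ofCore (Model.gnsCore hc)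
  have hin : ∀ a b : Alg d c, inner ℂ a b =
    Boson.form (Model.layer c) (Model.rep hc a 1) (Model.rep hc b 1) := fun _ _ => rfl
  have hadj : ∀ a x y : Alg d c, inner ℂ (a * x) y = inner ℂ x (star a * y) := fun a x y => by
    rw [hin, hin, map_mul, map_mul, Module.End.mul_apply, Module.End.mul_apply, Model.form_rep]
  -- Null vectors form a left ideal, by Cauchy–Schwarz for `⟨x, a^* a x⟩`; left multiplication thus
  -- descends to the quotient.
  have hzero : ∀ a x : Alg d c, ‖x‖ = 0 → ‖a * x‖ = 0 := fun a x hx => by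
    have h1 : ‖a * x‖ ^ 2 ≤ 0 := by
      rw [norm_sq_eq_re_inner (𝕜 := ℂ), hadj]
      refine (RCLike.re_le_norm _).trans ((norm_inner_le_norm _ _).trans ?_)
      rw [hx, zero_mul]
    exact pow_eq_zero_iff two_ne_zero |>.1 (le_antisymm h1 (sq_nonneg _))
  have hins : ∀ a x y : Alg d c, Inseparable x y →
      SeparationQuotient.mk (a * x) = SeparationQuotient.mk (a * y) := fun a x y h => by
    rw [SeparationQuotient.mk_eq_mk, Metric.inseparable_iff, dist_eq_norm, ← mul_sub]
    exact hzero _ _ (by rw [← dist_eq_norm]; exact Metric.inseparable_iff.1 h)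
  let op (a : Alg d c) : Module.End ℂ (SeparationQuotient (Alg d c)) :=
    { toFun := SeparationQuotient.lift (fun x => SeparationQuotient.mk (a * x)) (hins a)
      map_add' := fun x y => by
        obtain ⟨x, rfl⟩ := SeparationQuotient.surjective_mk x
        obtain ⟨y, rfl⟩ := SeparationQuotient.surjective_mk y
        rw [← SeparationQuotient.mk_add, SeparationQuotient.lift_mk, SeparationQuotient.lift_mk,
          SeparationQuotient.lift_mk, mul_add, SeparationQuotient.mk_add]
      map_smul' := fun z x => by
        obtain ⟨x, rfl⟩ := SeparationQuotient.surjective_mk x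
        rw [← SeparationQuotient.mk_smul, SeparationQuotient.lift_mk, SeparationQuotient.lift_mk,
          mul_smul_comm, SeparationQuotient.mk_smul, RingHom.id_apply] }
  have hop : ∀ a x : Alg d c, op a (SeparationQuotient.mk x) = SeparationQuotient.mk (a * x) :=
    fun _ _ => rfl
  let π : Alg d c →ₐ[ℂ] Module.End ℂ (SeparationQuotient (Alg d c)) :=
    { toFun := op
      map_one' := LinearMap.ext fun x => by
        obtain ⟨x, rfl⟩ := SeparationQuotient.surjective_mk x
        rw [hop, one_mul, Module.End.one_apply]
      map_mul' := fun a b => LinearMap.ext fun x => by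
        obtain ⟨x, rfl⟩ := SeparationQuotient.surjective_mk x
        rw [Module.End.mul_apply, hop, hop, hop, mul_assoc]
      map_zero' := LinearMap.ext fun x => by
        obtain ⟨x, rfl⟩ := SeparationQuotient.surjective_mk x
        rw [hop, zero_mul, LinearMap.zero_apply, SeparationQuotient.mk_zero]
      map_add' := fun a b => LinearMap.ext fun x => by
        obtain ⟨x, rfl⟩ := SeparationQuotient.surjective_mk x
        rw [LinearMap.add_apply, hop, hop, hop, add_mul, SeparationQuotient.mk_add]
      commutes' := fun z => LinearMap.ext fun x => by
        obtain ⟨x, rfl⟩ := SeparationQuotient.surjective_mk x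
        rw [hop, ← Algebra.smul_def, SeparationQuotient.mk_smul, Module.algebraMap_end_apply] }
  have hvac : ∀ a : Alg d c, Model.rep hc a 1 = 0 →
      π a (SeparationQuotient.mk 1) = 0 := fun a ha => by
    have h1 : inner ℂ (SeparationQuotient.mk (a * 1)) (SeparationQuotient.mk (a * 1)) =
        (0 : ℂ) := by
      rw [SeparationQuotient.inner_mk_mk, hin, mul_one, ha, map_zero]
    exact inner_self_eq_zero.1 h1
  refine ⟨SeparationQuotient (Alg d c), inferInstance, inferInstance, ⟨?_⟩⟩
  exact
    { π := π
      inner_π := fun a x y => by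
        obtain ⟨x, rfl⟩ := SeparationQuotient.surjective_mk x
        obtain ⟨y, rfl⟩ := SeparationQuotient.surjective_mk y
        exact hadj a x y
      vac := SeparationQuotient.mk 1
      norm_vac := by
        have h1 : ‖(SeparationQuotient.mk (1 : Alg d c))‖ ^ 2 = 1 := by
          rw [norm_sq_eq_re_inner (𝕜 := ℂ), SeparationQuotient.inner_mk_mk, hin,
            map_one (Model.rep hc), Module.End.one_apply, Boson.form_one_right]
          simp
        exact (pow_eq_one_iff_of_nonneg (norm_nonneg _) two_ne_zero).1 h1
      cyclic := fun x => by
        obtain ⟨x, rfl⟩ := SeparationQuotient.surjective_mk x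
        exact ⟨x, by change SeparationQuotient.mk (x * 1) = _; rw [mul_one]⟩
      B_vac := fun f => hvac _ (by
        rw [Alg.B, Model.rep_mk, Model.freeRep_of_B]
        exact Derivation.map_one_eq_zero _)
      N_vac := fun f => hvac _ (by
        rw [Alg.N, Model.rep_mk, Model.freeRep_of_N]
        exact Derivation.map_one_eq_zero _) }

end SWN

end

theorem theorem2p1 (d : ℕ) (c : ℝ) (hc : 0 < c) :
    -- the Fock representation exists
    (∃ (H : Type) (_ : NormedAddCommGroup H) (_ : InnerProductSpace ℂ H),
      Nonempty (SWN.FockRep d c H)) ∧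
    -- and it has the exponential vectors, with the inner products, that are claimed
    ∀ (H : Type*) [NormedAddCommGroup H] [InnerProductSpace ℂ H] (R : SWN.FockRep d c H),
      (∀ f : SWN.TestFun d, f.supNorm < 1 / 2 → R.ExpExists f) ∧
      ∀ f g : SWN.TestFun d, f.supNorm < 1 / 2 → g.supNorm < 1 / 2 →
        Integrable (fun t => Complex.log (1 - 4 * (conj (f t) * g t))) ∧
        inner ℂ (R.expVec f) (R.expVec g) =
          Complex.exp (-(c / 2) * ∫ t, Complex.log (1 - 4 * (conj (f t) * g t))) := by
  refine ⟨SWN.exists_fockRep d hc, fun H _ _ R => ⟨fun f hf => R.expExists hf, fun f g hf hg => ?_⟩⟩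
  obtain ⟨ρ, -, h1, h⟩ := SWN.TestFun.exists_bound hf hg
  exact ⟨SWN.integrable_log_one_sub ((f.integrable_conj_mul g).const_mul 4) h h1,
    (R.inner_expVec hf hg).trans (R.tsum_coef hf hg)⟩
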